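/- Let $0<q<1$ and write $(x;q)_n=\prod_{k=0}^{n-1}(1-xq^k)$. For a partition $\lambda$ with transpose $\lambda'$ and length $\ell(\lambda)$, put $n(\lambda)=\sum_{i\ge1}(i-1)\lambda_i$, $(x;q)_\lambda=\prod_{i=1}^{\ell(\lambda)}(xq^{1-i};q)_{\lambda_i}$ and $(x,y;q)_\lambda=(x;q)_\lambda(y;q)_\lambda$. Let $\mathrm{Sym}$ be the algebra of symmetric functions over $\mathbb C$. For a partition $\mu$ and $N\ge\ell(\mu)$ let $$I^A_{\mu|N}(x_1,\dots,x_N;q)=\frac{\det\bigl[\prod_{r=0}^{\mu_i+N-i-1}(x_j-q^{N-1-r})\bigr]_{i,j=1}^N}{\prod_{1\le i<j\le N}(x_i-x_j)},$$ and $I^A_{\mu|N}=0$ for $N<\ell(\mu)$. As $N\to\infty$ these symmetric polynomials (whose degrees are bounded) converge coefficientwise to an element $I^A_\mu(\,\cdot\,;q)\in\mathrm{Sym}$. A triple $(a,c,d)$ is called admissible if $a>0$ and one of the following holds: (1) $d=\bar c\in\mathbb C\setminus\mathbb R$; (2) $c,d$ are real and $aq^m<c,d<aq^{m-1}$ for some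 $m\in\mathbb Z$; (3) $c,d$ are real, $c,d<0$ and $q<cd^{-1}<q^{-1}$. For an admissible triple the $q$-Meixner symmetric functions are $$\Phi^{qM}_\lambda(X)=\sum_{\mu\subseteq\lambda}\sigma(\lambda,\mu)\,I^A_\mu(Xc;q),$$ where $Xc$ means that every variable is multiplied by $c$ and $$\sigma(\lambda,\mu)=c^{-|\lambda|}\Bigl(\frac{a}{qd}\Bigr)^{|\lambda|-|\mu|}q^{2\{n(\mu')-n(\mu)-n(\lambda')+n(\lambda)\}}\det\left[\frac{\bigl(\frac ca q^{\mu_k+2-k};q\bigr)_{\lambda_j-j-\mu_k+k}}{(q;q)_{\lambda_j-j-\mu_k+k}}\right]_{j,k=1}^{\ell(\lambda)},$$ an entry of the determinant being $0$ if $\lambda_j-j-\mu_k+k<0$. **Theorem.** Let $(a,c,d)$ be admissible. Then $\{\Phi^{qM}_\lambda\}$, with $\lambda$ ranging over all partitions, is a basis of $\mathrm{Sym}$. Let $\mathbb E:\mathrm{Sym}\to\mathbb C$ be the linear functional with $\mathbb E(\Phi^{qM}_\lambda)=\delta_{\lambda,\emptyset}$ and set $(F,G)=\mathbb E(FG)$.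 Then for all partitions $\lambda,\mu$ $$\bigl(\Phi^{qM}_\lambda,\Phi^{qM}_\mu\bigr)=\delta_{\lambda,\mu}\,h^{qM}_\lambda,\qquad h^{qM}_\lambda=q^{4\{n(\lambda)-n(\lambda')\}}\Bigl(\frac{a^2}{c^2d^2q^3}\Bigr)^{|\lambda|}\Bigl(\frac{cq}a,\frac{dq}a;q\Bigr)_\lambda,$$ and $h^{qM}_\lambda>0$ for every partition $\lambda$. -/

import Mathlib

open Filter Topology

noncomputable section

namespace QMeixner

/-! ### The algebra of symmetric functions over `ℂ` -/

/-- The algebra of symmetric functions over `ℂ`: formal power series of bounded degree in the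
variables `x₀, x₁, x₂, …` that are invariant under all permutations of the variables. -/
def SymFun : Subalgebra ℂ (MvPowerSeries ℕ ℂ) where
  carrier := {f | (∃ D : ℕ, ∀ α : ℕ →₀ ℕ, D < α.degree → MvPowerSeries.coeff α f = 0) ∧
    ∀ e : Equiv.Perm ℕ, MvPowerSeries.rename e f = f}
  mul_mem' := by
    rintro f g ⟨⟨D, hD⟩, hf⟩ ⟨⟨D', hD'⟩, hg⟩
    refine ⟨⟨D + D', fun α hα => ?_⟩, fun e => by rw [map_mul, hf, hg]⟩
    classical
    rw [MvPowerSeries.coeff_mul]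
    refine Finset.sum_eq_zero fun p hp => ?_
    have hp' : p.1.degree + p.2.degree = α.degree := by
      rw [← map_add, Finset.HasAntidiagonal.mem_antidiagonal.mp hp]
    rcases Nat.lt_or_ge D p.1.degree with h | h
    · rw [hD _ h, zero_mul]
    · rw [hD' _ (by omega), mul_zero]
  add_mem' := by
    rintro f g ⟨⟨D, hD⟩, hf⟩ ⟨⟨D', hD'⟩, hg⟩
    refine ⟨⟨max D D', fun α hα => ?_⟩, fun e => by rw [map_add, hf, hg]⟩
    rw [map_add, hD _ (lt_of_le_of_lt (le_max_left _ _) hα),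
      hD' _ (lt_of_le_of_lt (le_max_right _ _) hα), add_zero]
  algebraMap_mem' := by
    intro r
    refine ⟨⟨0, fun α hα => ?_⟩, fun e => AlgHom.commutes _ r⟩
    classical
    rw [MvPowerSeries.algebraMap_apply, MvPowerSeries.coeff_C, if_neg]
    · rintro rfl
      simp at hα

/-- The symmetric function `F(X c)`, obtained from `F(X)` by multiplying every variable
by `c`. -/
def dilate (c : ℂ) (F : SymFun) : SymFun :=
  ⟨MvPowerSeries.rescale (fun _ => c) (F : MvPowerSeries ℕ ℂ), by
    obtain ⟨f, ⟨D, hD⟩, hf⟩ := F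
    refine ⟨⟨D, fun α hα => ?_⟩, fun e => ?_⟩
    · rw [MvPowerSeries.coeff_rescale, hD α hα, mul_zero]
    · ext α
      obtain ⟨β, rfl⟩ : ∃ β, Finsupp.embDomain e.toEmbedding β = α :=
        ⟨Finsupp.embDomain e.symm.toEmbedding α, by
          ext i
          have := Finsupp.embDomain_apply_self e.toEmbedding
            (Finsupp.embDomain e.symm.toEmbedding α) (e.symm i)
          have h2 := Finsupp.embDomain_apply_self e.symm.toEmbedding α i
          simp only [Equiv.coe_toEmbedding, Equiv.apply_symm_apply] at this h2
          rw [this, h2]⟩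
      have key : ∀ g : MvPowerSeries ℕ ℂ,
          MvPowerSeries.coeff (Finsupp.embDomain e.toEmbedding β) (MvPowerSeries.rename e g)
            = MvPowerSeries.coeff β g :=
        fun g => MvPowerSeries.coeff_embDomain_rename e.toEmbedding g β
      have h1 := key f
      rw [hf e] at h1
      rw [key]
      simp only [MvPowerSeries.coeff_rescale, h1]
      congr 1
      rw [Finsupp.embDomain_eq_mapDomain,
        Finsupp.prod_mapDomain_index_inj e.toEmbedding.injective]⟩

/-- Convergence of a sequence of symmetric polynomials `F N ∈ Sym(N)` to a symmetric function
`G`: the degrees are bounded, and every coefficient of `F N` (viewed as a polynomial in the first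
`N` of the variables `x₀, x₁, …`) tends to the corresponding coefficient of `G`. For `N` at least
the degree, the coefficients of monomials in the first `N` variables determine the lift of `F N`
to the finite-dimensional space of symmetric functions of degree `≤ D`, so that this is the
convergence of the lifts in that space. -/
def ConvergesTo (F : (N : ℕ) → MvPolynomial (Fin N) ℂ) (G : SymFun) : Prop :=
  (∃ D : ℕ, ∀ N, (F N).totalDegree ≤ D) ∧
    ∀ α : ℕ →₀ ℕ,
      Tendsto (fun N => MvPolynomial.coeff α (MvPolynomial.rename Fin.val (F N))) atTop
        (𝓝 (MvPowerSeries.coeff α (G : MvPowerSeries ℕ ℂ)))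

/-! ### Multiparameter Schur polynomials -/

/-- The Newton polynomial `(x_j ∣ c₀, c₁, …)^m = (x_j - c₀) ⋯ (x_j - c_{m-1})`. -/
def newton {N : ℕ} (c : ℕ → ℂ) (m : ℕ) (j : Fin N) : MvPolynomial (Fin N) ℂ :=
  ∏ k ∈ Finset.range m, (MvPolynomial.X j - MvPolynomial.C (c k))

/-- The alternant `det [(x_j ∣ c₀, c₁, …)^{μ_i + N - i}]` (with `i` counted from `1`; here the
rows are counted from `0`). -/
def alternant (c : ℕ → ℂ) (N : ℕ) (mu : YoungDiagram) : MvPolynomial (Fin N) ℂ :=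
  Matrix.det (Matrix.of fun i j : Fin N => newton c (mu.rowLen i + (N - 1 - i)) j)

/-- The Vandermonde product `V(x_1, …, x_N) = ∏_{i < j} (x_i - x_j)`. -/
def vandermonde (N : ℕ) : MvPolynomial (Fin N) ℂ :=
  ∏ p ∈ (Finset.univ : Finset (Fin N × Fin N)) with p.1 < p.2,
    (MvPolynomial.X p.1 - MvPolynomial.X p.2)

theorem irreducible_X_sub_X {N : ℕ} {i j : Fin N} (hij : i ≠ j) :
    Irreducible (MvPolynomial.X i - MvPolynomial.X j : MvPolynomial (Fin N) ℂ) := by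
  classical
  have hi : MvPolynomial.coeff (Finsupp.single i 1)
      (MvPolynomial.X i - MvPolynomial.X j : MvPolynomial (Fin N) ℂ) = 1 := by
    rw [MvPolynomial.coeff_sub, MvPolynomial.coeff_X, MvPolynomial.coeff_X, if_pos rfl, if_neg,
      sub_zero]
    rw [Finsupp.single_left_inj one_ne_zero]
    exact hij.symm
  refine MvPolynomial.irreducible_of_totalDegree_eq_one (le_antisymm ?_ ?_) fun x hx => ?_
  · refine (MvPolynomial.totalDegree_sub _ _).trans ?_
    simp
  · have := MvPolynomial.le_totalDegree (p := (MvPolynomial.X i - MvPolynomial.X j :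
      MvPolynomial (Fin N) ℂ)) (s := Finsupp.single i 1) (by
        rw [MvPolynomial.mem_support_iff, hi]; exact one_ne_zero)
    simpa using this
  · exact isUnit_of_dvd_one (hi ▸ hx (Finsupp.single i 1))

theorem vandermonde_dvd_alternant (c : ℕ → ℂ) (N : ℕ) (mu : YoungDiagram) :
    vandermonde N ∣ alternant c N mu := by
  classical
  refine Finset.prod_dvd_of_isRelPrime ?_ ?_
  · rintro ⟨i, j⟩ hij ⟨k, l⟩ hkl hne
    have hij : i < j := by simpa using hij
    have hkl : k < l := by simpa using hkl
    refine (irreducible_X_sub_X hij.ne).isRelPrime_iff_not_dvd.mpr ?_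
    rintro ⟨g, hg⟩
    have := congrArg (MvPolynomial.eval
      (fun m : Fin N => (((if m = j then i else m : Fin N) : ℕ) : ℂ))) hg
    simp only [map_sub, map_mul, MvPolynomial.eval_X, if_true, if_neg hij.ne, sub_self,
      zero_mul, sub_eq_zero, Nat.cast_inj] at this
    have h2 := Fin.ext this
    grind
  · rintro ⟨i, j⟩ hij
    have hij : i < j := by simpa using hij
    rw [← Ideal.mem_span_singleton, ← Ideal.Quotient.eq_zero_iff_mem, alternant, RingHom.map_det]
    refine Matrix.det_zero_of_column_eq hij.ne fun k => ?_
    have hX : Ideal.Quotient.mk (Ideal.span {(MvPolynomial.X i - MvPolynomial.X j :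
        MvPolynomial (Fin N) ℂ)}) (MvPolynomial.X i) = Ideal.Quotient.mk _ (MvPolynomial.X j) :=
      Ideal.Quotient.eq.mpr (Ideal.mem_span_singleton_self _)
    simp [newton, map_prod, hX]

/-- The multiparameter Schur polynomial `s_{μ∣N}(x_1, …, x_N ∣ c₀, c₁, …)`: the quotient of the
alternant by the Vandermonde product if `μ` has at most `N` rows, and `0` otherwise. -/
def multiSchur (c : ℕ → ℂ) (N : ℕ) (mu : YoungDiagram) : MvPolynomial (Fin N) ℂ :=
  if mu.colLen 0 ≤ N then (vandermonde_dvd_alternant c N mu).choose else 0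

/-! ### Interpolation symmetric functions of type A -/

/-- `I^A_{μ∣N}(x_1, …, x_N; q) = s_{μ∣N}(x_1, …, x_N ∣ q^{N-1}, q^{N-2}, …)`. -/
def interpPoly (q : ℝ) (mu : YoungDiagram) (N : ℕ) : MvPolynomial (Fin N) ℂ :=
  multiSchur (fun i => (q : ℂ) ^ ((N : ℤ) - (i : ℤ) - 1)) N mu

open Classical in
/-- The interpolation symmetric function `I^A_μ(·; q)`, the limit of `I^A_{μ∣N}(·; q)` as
`N → ∞` (which is unique; the default value `0` is only used if there were no limit). -/
def interpFun (q : ℝ) (mu : YoungDiagram) : SymFun :=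
  if h : ∃ G : SymFun, ConvergesTo (interpPoly q mu) G then h.choose else 0

/-! ### Partitions and `q`-Pochhammer symbols -/

/-- `n(λ) = ∑_{i ≥ 1} (i - 1) λ_i`. -/
def nStat (l : YoungDiagram) : ℤ :=
  ∑ i ∈ Finset.range (l.colLen 0), (i : ℤ) * (l.rowLen i : ℤ)

/-- `(x; q)_n = ∏_{k=0}^{n-1} (1 - x q^k)`. -/
def qPoch (x q : ℂ) (n : ℕ) : ℂ :=
  ∏ k ∈ Finset.range n, (1 - x * q ^ k)

/-- `(x; q)_λ = ∏_{i=1}^{ℓ(λ)} (x q^{1-i}; q)_{λ_i}` (rows are counted from `0` here). -/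
def qPochPartition (x q : ℂ) (l : YoungDiagram) : ℂ :=
  ∏ i ∈ Finset.range (l.colLen 0), qPoch (x * q ^ (-(i : ℤ))) q (l.rowLen i)

theorem finite_Iic (l : YoungDiagram) : (Set.Iic l).Finite := by
  refine Set.Finite.of_finite_image (f := YoungDiagram.cells) ?_
    (fun _ _ _ _ h => YoungDiagram.ext h)
  refine (Finset.finite_toSet l.cells.powerset).subset ?_
  rintro _ ⟨m, hm, rfl⟩
  simpa using YoungDiagram.cells_subset_iff.mpr hm

/-- The partitions `μ ⊆ λ`. -/
def subdiagrams (l : YoungDiagram) : Finset YoungDiagram :=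
  (finite_Iic l).toFinset

/-! ### `q`-Meixner symmetric functions -/

/-- Admissible triples of parameters: `a > 0` and one of the following holds:
`d` is the complex conjugate of the nonreal number `c`; or `c, d` are real with
`a q^m < c, d < a q^{m-1}` for some integer `m`; or `c, d` are real and negative with
`q < c d⁻¹ < q⁻¹`. -/
def IsAdmissible (q a : ℝ) (c d : ℂ) : Prop :=
  0 < a ∧
    ((c.im ≠ 0 ∧ d = (starRingEnd ℂ) c) ∨
      (∃ c' d' : ℝ, c = c' ∧ d = d' ∧ ∃ m : ℤ,
        (a * q ^ m < c' ∧ c' < a * q ^ (m - 1)) ∧ (a * q ^ m < d' ∧ d' < a * q ^ (m - 1))) ∨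
      (∃ c' d' : ℝ, c = c' ∧ d = d' ∧
        c' < 0 ∧ d' < 0 ∧ q < c' * d'⁻¹ ∧ c' * d'⁻¹ < q⁻¹))

/-- The entry with indices `j, k = 1, …, ℓ(λ)` (counted from `0` here) of the determinant in
`σ(λ, μ; q; a, c, d)`, which is `(c q^{μ_k+2-k} / a; q)_r / (q; q)_r` for
`r = λ_j - j - μ_k + k`; by the usual convention `1 / (q; q)_r = 0` for negative `r`. -/
def sigmaEntry (q a : ℝ) (c : ℂ) (l m : YoungDiagram) (j k : ℕ) : ℂ :=
  let r : ℤ := (l.rowLen j : ℤ) - j - m.rowLen k + k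
  if 0 ≤ r then
    qPoch (c / a * (q : ℂ) ^ ((m.rowLen k : ℤ) + 2 - (k + 1))) q r.toNat / qPoch q q r.toNat
  else 0

/-- The coefficient `σ^{qM}(λ, μ; q; a, c, d)`. -/
def sigmaCoeff (q a : ℝ) (c d : ℂ) (l m : YoungDiagram) : ℂ :=
  c ^ (-(l.card : ℤ)) * (a / (q * d)) ^ ((l.card : ℤ) - m.card) *
    (q : ℂ) ^ (2 * (nStat m.transpose - nStat m - nStat l.transpose + nStat l)) *
    Matrix.det (Matrix.of fun j k : Fin (l.colLen 0) => sigmaEntry q a c l m j k)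

/-- The `q`-Meixner symmetric function
`Φ^{qM}_λ(X; q; a, c, d) = ∑_{μ ⊆ λ} σ^{qM}(λ, μ; q; a, c, d) I^A_μ(X c; q)`. -/
def qMeixner (q a : ℝ) (c d : ℂ) (l : YoungDiagram) : SymFun :=
  ∑ m ∈ subdiagrams l, sigmaCoeff q a c d l m • dilate c (interpFun q m)

/-- The moment functional of a basis `(Φ_λ)` of the algebra of symmetric functions: the linear
functional with `E(Φ_λ) = δ_{λ,∅}`, i.e. the coefficient of `Φ_∅` in the basis expansion. -/
def momentFunctional (b : Module.Basis YoungDiagram ℂ SymFun) : SymFun →ₗ[ℂ] ℂ :=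
  b.coord ⊥

/-- The bilinear form `(F, G) = E(F G)` attached to a basis. -/
def momentForm (b : Module.Basis YoungDiagram ℂ SymFun) (F G : SymFun) : ℂ :=
  momentFunctional b (F * G)

/-- The squared norm
`h^{qM}_λ = q^{4 (n(λ) - n(λ'))} (a² / (c² d² q³))^{|λ|} (c q / a, d q / a; q)_λ`. -/
def normSqMeixner (q a : ℝ) (c d : ℂ) (l : YoungDiagram) : ℂ :=
  (q : ℂ) ^ (4 * (nStat l - nStat l.transpose)) *
    ((a : ℂ) ^ 2 / (c ^ 2 * d ^ 2 * (q : ℂ) ^ 3)) ^ l.card *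
    (qPochPartition (c * q / a) q l * qPochPartition (d * q / a) q l)

end QMeixner

end

noncomputable section

namespace QMeixner

/-! ### Gaussian binomial coefficients and Newton polynomials -/

/-! The orthogonality is the limit, as N tends to infinity, of an exact orthogonality in N
variables, and that one is a determinantal lift of a family of orthogonal polynomials in one
variable.

One variable. A linear functional M on polynomials is prescribed by its values on the Newton
polynomials with nodes u, u/q, u/q², …. Under two compatibility conditions on its parameters, M also
has a product formula on products of two Newton polynomials, with nodes starting at u and at v
(`uniMoment_mul`). The q-binomial theorem then gives explicit monic orthogonal polynomials and their
norms (`uniMoment_orthoPoly_mul`). Everything is algebraic; no positive measure is needed.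

N variables. With p_n the orthogonal polynomials and V the Vandermonde product, the quotients
det[p_{λ_i+N-i}(x_j)]/V are orthogonal for M ⊗ ⋯ ⊗ M weighted by V², by Andréief's identity. Take u
= q^{N-1}, so that the nodes are those of the interpolation polynomials. A Cauchy–Binet expansion,
from orthogonal to Newton to monomial alternants, shows that N enters the expansion in Schur
polynomials only through the numbers r_N(μ) = `rowRatio`, which tend to 1. Exactly, the quotient is
c^{|λ|} r_N(λ) times the restriction to N variables of S_N(Φ_λ). Here Φ_λ is the q-Meixner function
before dilation, and S_N = `schurScale` divides each Schur function s_ν by r_N(ν)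
(`polyDet_orthoPoly`).

Limit. Let E_N be the normalised expectation and E the functional that reads off the coefficient of
Φ_∅. Orthogonality to Φ_∅ = 1 gives E_N(S_N f) = E(f) for all large N. Since S_N is diagonal on
Schur functions with eigenvalues tending to 1, E_N(f) tends to E(f) and E_N(S_N f · S_N g) tends to
E(fg). For f = Φ_λ and g = Φ_μ the left side is known exactly, and its limit is the claim
(`coord_meixnerCore_mul`). Dilation by c, an algebra automorphism, transports the result to the
stated functions. Admissibility makes every factor (1 - cq^k/a)(1 - dq^k/a) positive; this gives h >
0 and keeps the normalisation of E_N from vanishing. -/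

theorem qPoch_succ (x q : ℂ) (n : ℕ) : qPoch x q (n + 1) = qPoch x q n * (1 - x * q ^ n) :=
  Finset.prod_range_succ _ _

theorem qPoch_zero (x q : ℂ) : qPoch x q 0 = 1 := Finset.prod_range_zero _

theorem qPoch_add (x q : ℂ) (m n : ℕ) :
    qPoch x q (m + n) = qPoch x q m * qPoch (x * q ^ m) q n := by
  simp only [qPoch, Finset.prod_range_add]
  congr 1
  exact Finset.prod_congr rfl fun k _ => by ring

/-- The Gaussian binomial coefficient, as a quotient of `q`-factorials. -/
def gaussBinom (q : ℂ) (n k : ℕ) : ℂ :=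
  if k ≤ n then qPoch q q n / (qPoch q q k * qPoch q q (n - k)) else 0

section gauss

variable {q : ℂ} (hw : ∀ n, qPoch q q n ≠ 0)
include hw

theorem gaussBinom_zero (n : ℕ) : gaussBinom q n 0 = 1 := by
  simp [gaussBinom, qPoch_zero, hw]

theorem gaussBinom_self (n : ℕ) : gaussBinom q n n = 1 := by
  simp [gaussBinom, qPoch_zero, hw]

theorem gaussBinom_pascal {n k : ℕ} (hk : k ≤ n) :
    gaussBinom q (n + 1) (k + 1) =
      gaussBinom q n (k + 1) + q ^ (n - k) * gaussBinom q n k := by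
  obtain ⟨r, rfl⟩ := Nat.exists_eq_add_of_le hk
  rcases r with _ | r
  · simp [gaussBinom, qPoch_zero, hw]
  · have e1 : k + (r + 1) + 1 - (k + 1) = r + 1 := by omega
    have e2 : k + (r + 1) - (k + 1) = r := by omega
    have e3 : k + (r + 1) - k = r + 1 := by omega
    rw [gaussBinom, gaussBinom, gaussBinom, if_pos (by omega), if_pos (by omega),
      if_pos (by omega), e1, e2, e3]
    have h1 := hw k
    have h2 := hw r
    have h3 := hw (k + 1)
    have h4 := hw (r + 1)
    rw [qPoch_succ] at h3 h4
    rw [qPoch_succ q q (k + (r + 1)), qPoch_succ q q k, qPoch_succ q q r]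
    have h5 : (1 - q * q ^ k) ≠ 0 := right_ne_zero_of_mul h3
    have h6 : (1 - q * q ^ r) ≠ 0 := right_ne_zero_of_mul h4
    field_simp
    ring

/-- The finite `q`-binomial theorem. -/
theorem prod_sub_eq_sum_gaussBinom (y : Polynomial ℂ) (z : ℂ) (n : ℕ) :
    ∏ r ∈ Finset.range n, (y - Polynomial.C (z * q ^ r)) =
      ∑ k ∈ Finset.range (n + 1),
        Polynomial.C (gaussBinom q n k * ((-1) ^ k * q ^ k.choose 2 * z ^ k)) * y ^ (n - k) := by
  induction n with
  | zero => simp [gaussBinom_zero hw]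
  | succ n ih =>
    rw [Finset.prod_range_succ, ih, Finset.sum_range_succ' _ (n + 1), mul_sub, Finset.sum_mul,
      Finset.sum_mul]
    have h1 : ∀ k ∈ Finset.range (n + 1),
        Polynomial.C (gaussBinom q (n + 1) (k + 1) *
          ((-1) ^ (k + 1) * q ^ (k + 1).choose 2 * z ^ (k + 1))) * y ^ (n + 1 - (k + 1)) =
        Polynomial.C (gaussBinom q n (k + 1) *
          ((-1) ^ (k + 1) * q ^ (k + 1).choose 2 * z ^ (k + 1))) * y ^ (n - k) -
        Polynomial.C (gaussBinom q n k * ((-1) ^ k * q ^ k.choose 2 * z ^ k)) * y ^ (n - k) *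
          Polynomial.C (z * q ^ n) := by
      intro k hk
      have hk' : k ≤ n := Nat.lt_succ_iff.mp (Finset.mem_range.mp hk)
      rw [gaussBinom_pascal hw hk', Nat.add_sub_add_right, mul_right_comm _ _ (Polynomial.C _),
        ← Polynomial.C_mul, ← sub_mul, ← Polynomial.C_sub]
      congr 2
      rw [Nat.choose_succ_succ' k 1, Nat.choose_one_right]
      have : q ^ n = q ^ (n - k) * q ^ k := by rw [← pow_add, Nat.sub_add_cancel hk']
      rw [this]
      ring
    rw [Finset.sum_congr rfl h1, Finset.sum_sub_distrib]
    have h2 : ∑ k ∈ Finset.range (n + 1), Polynomial.C (gaussBinom q n k *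
          ((-1) ^ k * q ^ k.choose 2 * z ^ k)) * y ^ (n - k) * y =
        ∑ k ∈ Finset.range (n + 2), Polynomial.C (gaussBinom q n k *
          ((-1) ^ k * q ^ k.choose 2 * z ^ k)) * y ^ (n + 1 - k) := by
      rw [Finset.sum_range_succ _ (n + 1)]
      have : gaussBinom q n (n + 1) = 0 := by simp [gaussBinom]
      rw [this, zero_mul, Polynomial.C_0, zero_mul, add_zero]
      refine Finset.sum_congr rfl fun k hk => ?_
      rw [mul_assoc, ← pow_succ, Nat.sub_add_comm (Nat.lt_succ_iff.mp (Finset.mem_range.mp hk))]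
    rw [h2, Finset.sum_range_succ' _ (n + 1)]
    simp [gaussBinom_zero hw]
    ring

theorem qPoch_eq_sum_gaussBinom (z : ℂ) (n : ℕ) :
    qPoch z q n =
      ∑ k ∈ Finset.range (n + 1), gaussBinom q n k * ((-1) ^ k * q ^ k.choose 2 * z ^ k) := by
  have := congrArg (Polynomial.eval 0) (prod_sub_eq_sum_gaussBinom hw 1 z n)
  simpa [Polynomial.eval_prod, Polynomial.eval_finsetSum, qPoch] using this

end gauss

/-- The univariate Newton polynomial with nodes `u, u q⁻¹, u q⁻², …`. -/
def newtonUni (q u : ℂ) (n : ℕ) : Polynomial ℂ :=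
  ∏ r ∈ Finset.range n, (Polynomial.X - Polynomial.C (u * q⁻¹ ^ r))

theorem newtonUni_monic (q u : ℂ) (n : ℕ) : (newtonUni q u n).Monic :=
  Polynomial.monic_prod_of_monic _ _ fun _ _ => Polynomial.monic_X_sub_C _

theorem newtonUni_natDegree (q u : ℂ) (n : ℕ) : (newtonUni q u n).natDegree = n := by
  rw [newtonUni, Polynomial.natDegree_prod_of_monic _ _ fun _ _ => Polynomial.monic_X_sub_C _,
    Finset.sum_congr rfl fun _ _ => Polynomial.natDegree_X_sub_C _]
  simp

theorem newtonUni_succ (q u : ℂ) (n : ℕ) :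
    newtonUni q u (n + 1) = newtonUni q u n * (Polynomial.X - Polynomial.C (u * q⁻¹ ^ n)) :=
  Finset.prod_range_succ _ _

theorem newtonUni_zero (q u : ℂ) : newtonUni q u 0 = 1 := Finset.prod_range_zero _

/-- Read in reverse order, the nodes are z, zq, zq², … with z = u q^{-(n-1)}, so the q-binomial
theorem applies with y = X. -/
theorem coeff_newtonUni {q : ℂ} (hw : ∀ n, qPoch q q n ≠ 0) (hq : q ≠ 0) (u : ℂ) {n m : ℕ}
    (hm : m ≤ n) :
    (newtonUni q u n).coeff m = gaussBinom q n (n - m) *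
      ((-1) ^ (n - m) * q ^ (n - m).choose 2 * (u * q⁻¹ ^ (n - 1)) ^ (n - m)) := by
  have h1 : newtonUni q u n =
      ∏ r ∈ Finset.range n, (Polynomial.X - Polynomial.C (u * q⁻¹ ^ (n - 1) * q ^ r)) := by
    rw [newtonUni, ← Finset.prod_range_reflect]
    refine Finset.prod_congr rfl fun r hr => ?_
    have hr' := Finset.mem_range.mp hr
    have : q⁻¹ ^ (n - 1) = q⁻¹ ^ (n - 1 - r) * q⁻¹ ^ r := by
      rw [← pow_add]; congr 1; omega
    rw [this, mul_assoc, mul_assoc, ← mul_pow, inv_mul_cancel₀ hq, one_pow, mul_one]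
  rw [h1, prod_sub_eq_sum_gaussBinom hw, Polynomial.finsetSum_coeff,
    Finset.sum_eq_single (n - m)]
  · rw [Polynomial.coeff_C_mul, Nat.sub_sub_self hm, Polynomial.coeff_X_pow_self, mul_one]
  · intro k hk hne
    have := Finset.mem_range.mp hk
    rw [Polynomial.coeff_C_mul, Polynomial.coeff_X_pow, if_neg (by omega), mul_zero]
  · intro h
    exact absurd (Finset.mem_range.mpr (by omega)) h

/-- The Newton polynomials as a polynomial sequence. -/
def newtonSeq (q u : ℂ) : Polynomial.Sequence ℂ where
  elems' := newtonUni q u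
  degree_eq' n := by
    rw [Polynomial.degree_eq_natDegree (newtonUni_monic q u n).ne_zero, newtonUni_natDegree]

theorem newtonSeq_apply (q u : ℂ) (n : ℕ) : newtonSeq q u n = newtonUni q u n := rfl

theorem newtonSeq_isUnit (q u : ℂ) (n : ℕ) : IsUnit (newtonSeq q u n).leadingCoeff := by
  rw [newtonSeq_apply, (newtonUni_monic q u n).leadingCoeff]
  exact isUnit_one

/-- The basis of Newton polynomials. -/
def newtonBasis (q u : ℂ) : Module.Basis ℕ ℂ (Polynomial ℂ) :=
  (newtonSeq q u).basis (newtonSeq_isUnit q u)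

theorem newtonBasis_apply (q u : ℂ) (n : ℕ) : newtonBasis q u n = newtonUni q u n :=
  (newtonSeq q u).basis_eq_self _ n

/-! ### The univariate moment functional and its orthogonal polynomials -/

/-- The linear functional with `(newtonUni q u k) ↦ A^k q^{-k(k-1)/2} (β; q)_k`. -/
def uniMoment (q u A β : ℂ) : Polynomial ℂ →ₗ[ℂ] ℂ :=
  (newtonBasis q u).constr ℂ fun k => A ^ k * q⁻¹ ^ k.choose 2 * qPoch β q k

theorem choose_two_add (k j : ℕ) :
    (k + j).choose 2 = k.choose 2 + j.choose 2 + k * j := by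
  induction j with
  | zero => simp
  | succ j ih =>
    rw [← add_assoc, Nat.choose_succ_succ' (k + j) 1, Nat.choose_succ_succ' j 1, ih]
    simp only [Nat.choose_one_right]
    ring

/-- Trading a factor x - v q^{-j} for x - u q^{-k} gives a recursion that lowers j and raises k. The
two conditions on A are exactly what this recursion needs to be solved by a product, symmetric under
the exchange of (u, β) with (v, γ). -/
theorem uniMoment_mul {q u v A β γ : ℂ} (hq : q ≠ 0) (hβ : A * β = -v) (hγ : A * γ = -u)
    (k j : ℕ) :
    uniMoment q u A β (newtonUni q u k * newtonUni q v j) =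
      A ^ (k + j) * q⁻¹ ^ (k + j).choose 2 * qPoch β q k * qPoch γ q j := by
  induction j generalizing k with
  | zero =>
    rw [newtonUni_zero, mul_one, ← newtonBasis_apply, uniMoment, Module.Basis.constr_basis]
    simp [qPoch_zero]
  | succ j ih =>
    have h1 : newtonUni q u k * newtonUni q v (j + 1) =
        newtonUni q u (k + 1) * newtonUni q v j +
          (u * q⁻¹ ^ k - v * q⁻¹ ^ j) • (newtonUni q u k * newtonUni q v j) := by
      rw [newtonUni_succ, newtonUni_succ, Polynomial.smul_eq_C_mul, Polynomial.C_sub]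
      ring
    rw [h1, map_add, map_smul, ih, ih, smul_eq_mul, qPoch_succ, qPoch_succ,
      show k + 1 + j = (k + j) + 1 by ring, show k + (j + 1) = (k + j) + 1 by ring,
      Nat.choose_succ_succ' (k + j) 1, Nat.choose_one_right]
    have hu : u = - (A * γ) := by rw [hγ, neg_neg]
    have hv : v = - (A * β) := by rw [hβ, neg_neg]
    rw [hu, hv]
    simp only [pow_add, pow_succ, inv_pow]
    field_simp
    ring

/-- The Newton coefficients of the orthogonal polynomials. -/
def orthoCoeff (q A β : ℂ) (n k : ℕ) : ℂ :=
  if k ≤ n then (-A) ^ (n - k) * (q ^ k.choose 2 / q ^ n.choose 2) ^ 2 * gaussBinom q n k *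
    qPoch (β * q ^ k) q (n - k) else 0

/-- The monic orthogonal polynomials of `uniMoment q u A β`. -/
def orthoPoly (q u A β : ℂ) (n : ℕ) : Polynomial ℂ :=
  ∑ k ∈ Finset.range (n + 1), orthoCoeff q A β n k • newtonUni q u k

theorem orthoCoeff_self {q : ℂ} (hw : ∀ n, qPoch q q n ≠ 0) (hq : q ≠ 0) (A β : ℂ) (n : ℕ) :
    orthoCoeff q A β n n = 1 := by
  simp [orthoCoeff, gaussBinom_self hw, qPoch_zero, hq]

theorem orthoPoly_monic_natDegree {q : ℂ} (hw : ∀ n, qPoch q q n ≠ 0) (hq : q ≠ 0)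
    (u A β : ℂ) (n : ℕ) :
    (orthoPoly q u A β n).Monic ∧ (orthoPoly q u A β n).natDegree = n := by
  have hlow : (∑ k ∈ Finset.range n, orthoCoeff q A β n k • newtonUni q u k).degree <
      (newtonUni q u n).degree := by
    refine lt_of_le_of_lt (Polynomial.degree_sum_le _ _) ?_
    rw [Finset.sup_lt_iff (by
      rw [bot_lt_iff_ne_bot, ne_eq, Polynomial.degree_eq_bot]
      exact (newtonUni_monic q u n).ne_zero)]
    intro k hk
    refine lt_of_le_of_lt (Polynomial.degree_smul_le _ _) ?_
    rw [Polynomial.degree_eq_natDegree (newtonUni_monic q u n).ne_zero,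
      Polynomial.degree_eq_natDegree (newtonUni_monic q u k).ne_zero, newtonUni_natDegree,
      newtonUni_natDegree]
    exact_mod_cast Finset.mem_range.mp hk
  have h : orthoPoly q u A β n =
      (∑ k ∈ Finset.range n, orthoCoeff q A β n k • newtonUni q u k) + newtonUni q u n := by
    rw [orthoPoly, Finset.sum_range_succ, orthoCoeff_self hw hq, one_smul]
  rw [h]
  refine ⟨(newtonUni_monic q u n).add_of_right hlow, ?_⟩
  rw [Polynomial.natDegree_add_eq_right_of_degree_lt hlow, newtonUni_natDegree]

section ortho

variable {q u v A β γ : ℂ} (hw : ∀ n, qPoch q q n ≠ 0) (hq : q ≠ 0) (hβ : A * β = -v)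
  (hγ : A * γ = -u)
include hw hq hβ hγ

/-- The product (β;q)_k (βq^k;q)_{n-k} = (β;q)_n does not depend on k, and the exponent of q splits
off q^{-kj}. What is left of the sum over k is the q-binomial expansion of (q^{-j};q)_n. -/
theorem uniMoment_orthoPoly_mul_newtonUni (n j : ℕ) :
    uniMoment q u A β (orthoPoly q u A β n * newtonUni q v j) =
      (-1) ^ n * A ^ (n + j) * qPoch β q n * qPoch γ q j *
        (q⁻¹ ^ n.choose 2) ^ 2 * q⁻¹ ^ j.choose 2 * qPoch (q⁻¹ ^ j) q n := by
  rw [orthoPoly, Finset.sum_mul, map_sum, qPoch_eq_sum_gaussBinom hw (q⁻¹ ^ j), Finset.mul_sum]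
  refine Finset.sum_congr rfl fun k hk => ?_
  have hk' : k ≤ n := Nat.lt_succ_iff.mp (Finset.mem_range.mp hk)
  obtain ⟨r, rfl⟩ := Nat.exists_eq_add_of_le hk'
  rw [smul_mul_assoc, map_smul, uniMoment_mul hq hβ hγ, orthoCoeff, if_pos hk', smul_eq_mul,
    Nat.add_sub_cancel_left, qPoch_add β q k r, choose_two_add k j]
  have h1 : ((-1 : ℂ) ^ k) * (-1) ^ k = 1 := by rw [← mul_pow]; simp
  have h2 : (-1 : ℂ) ^ (k + r) * (-1) ^ k = (-1) ^ r := by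
    rw [pow_add, mul_right_comm, h1, one_mul]
  have h3 : q⁻¹ ^ (k * j) = (q⁻¹ ^ j) ^ k := by rw [mul_comm, pow_mul]
  rw [neg_pow, ← h2, pow_add q⁻¹, pow_add q⁻¹, h3]
  simp only [inv_pow, pow_add]
  field_simp

/-- The Newton polynomials with nodes starting at v span each space of bounded degree, and
(q^{-j};q)_n contains the factor 1 - q^{-j}q^j when j < n. -/
theorem uniMoment_orthoPoly_mul_eq_zero {n : ℕ} {F : Polynomial ℂ} (hF : F.degree < n) :
    uniMoment q u A β (orthoPoly q u A β n * F) = 0 := by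
  have hmem : F ∈ Submodule.span ℂ ((newtonSeq q v) '' Set.Iio n) := by
    rw [(newtonSeq q v).span_degreeLT fun i _ => newtonSeq_isUnit q v i]
    exact Polynomial.mem_degreeLT.mpr hF
  have hle : Submodule.span ℂ ((newtonSeq q v) '' Set.Iio n) ≤
      LinearMap.ker (uniMoment q u A β ∘ₗ LinearMap.mulLeft ℂ (orthoPoly q u A β n)) := by
    refine Submodule.span_le.mpr ?_
    rintro _ ⟨j, hj, rfl⟩
    have : qPoch (q⁻¹ ^ j) q n = 0 := by
      refine Finset.prod_eq_zero (Finset.mem_range.mpr hj) ?_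
      rw [← mul_pow, inv_mul_cancel₀ hq, one_pow, sub_self]
    rw [SetLike.mem_coe, LinearMap.mem_ker, LinearMap.comp_apply, LinearMap.mulLeft_apply,
      newtonSeq_apply, uniMoment_orthoPoly_mul_newtonUni hw hq hβ hγ, this, mul_zero]
  simpa using hle hmem

omit hw hβ hγ in
theorem qPoch_inv_pow_self (n : ℕ) :
    qPoch (q⁻¹ ^ n) q n = (-1) ^ n * q⁻¹ ^ (n.choose 2 + n) * qPoch q q n := by
  induction n with
  | zero => simp [qPoch_zero]
  | succ n ih =>
    have h1 : qPoch (q⁻¹ ^ (n + 1)) q (n + 1) =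
        (1 - q⁻¹ ^ (n + 1)) * qPoch (q⁻¹ ^ n) q n := by
      rw [add_comm n 1, qPoch_add, qPoch_succ, qPoch_zero]
      congr 2
      · ring
      · rw [add_comm 1 n, pow_succ]
        field_simp
    rw [h1, ih, qPoch_succ, Nat.choose_succ_succ' n 1, Nat.choose_one_right]
    simp only [inv_pow, pow_add, pow_succ]
    field_simp
    ring

/-- The squared norm of `orthoPoly q u A β n`, where `γ` is the second parameter. -/
def orthoNorm (q A β γ : ℂ) (n : ℕ) : ℂ :=
  A ^ (2 * n) * (q⁻¹ ^ n.choose 2) ^ 4 * q⁻¹ ^ n * qPoch q q n * qPoch β q n * qPoch γ q n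

/-- Two monic polynomials of degree n differ by a lower degree, so one factor may be replaced by the
Newton polynomial of degree n with nodes starting at v. This is how γ enters the norm. -/
theorem uniMoment_orthoPoly_mul_self (n : ℕ) :
    uniMoment q u A β (orthoPoly q u A β n * orthoPoly q u A β n) = orthoNorm q A β γ n := by
  obtain ⟨hm, hd⟩ := orthoPoly_monic_natDegree hw hq u A β n
  have hdeg : (orthoPoly q u A β n - newtonUni q v n).degree < n := by
    refine lt_of_lt_of_le (Polynomial.degree_sub_lt_left ?_ hm.ne_zero ?_) ?_
    · rw [Polynomial.degree_eq_natDegree hm.ne_zero,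
        Polynomial.degree_eq_natDegree (newtonUni_monic q v n).ne_zero, hd, newtonUni_natDegree]
    · rw [hm.leadingCoeff, (newtonUni_monic q v n).leadingCoeff]
    · rw [Polynomial.degree_eq_natDegree hm.ne_zero, hd]
  have h := uniMoment_orthoPoly_mul_eq_zero hw hq hβ hγ hdeg
  rw [mul_sub, map_sub, sub_eq_zero] at h
  rw [h, uniMoment_orthoPoly_mul_newtonUni hw hq hβ hγ, qPoch_inv_pow_self hq, orthoNorm,
    pow_add q⁻¹, show n + n = 2 * n by ring]
  have h1 : ((-1 : ℂ) ^ n) * (-1) ^ n = 1 := by rw [← mul_pow]; simp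
  linear_combination (A ^ (2 * n) * (q⁻¹ ^ n.choose 2) ^ 4 * q⁻¹ ^ n * qPoch q q n *
    qPoch β q n * qPoch γ q n) * h1

theorem uniMoment_orthoPoly_mul (n m : ℕ) :
    uniMoment q u A β (orthoPoly q u A β n * orthoPoly q u A β m) =
      if n = m then orthoNorm q A β γ n else 0 := by
  have key : ∀ n m : ℕ, m < n →
      uniMoment q u A β (orthoPoly q u A β n * orthoPoly q u A β m) = 0 := by
    intro n m hmn
    refine uniMoment_orthoPoly_mul_eq_zero hw hq hβ hγ ?_
    obtain ⟨hm, hd⟩ := orthoPoly_monic_natDegree hw hq u A β m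
    rw [Polynomial.degree_eq_natDegree hm.ne_zero, hd]
    exact_mod_cast hmn
  split_ifs with h
  · rw [← h, uniMoment_orthoPoly_mul_self hw hq hβ hγ]
  · rcases Nat.lt_or_gt_of_ne h with h | h
    · rw [mul_comm, key m n h]
    · exact key n m h

end ortho

/-! ### Tensor products of univariate functionals -/

section tensor

variable {N : ℕ} {A : Type*} [CommRing A] [Algebra ℂ A]

/-- The linear map on polynomials in `N` variables with
`∏ F_j(x_j) ↦ ∏ t_j(F_j)`. -/
def tensorMap (t : Fin N → (Polynomial ℂ →ₗ[ℂ] A)) : MvPolynomial (Fin N) ℂ →ₗ[ℂ] A :=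
  (MvPolynomial.basisMonomials (Fin N) ℂ).constr ℂ fun α => ∏ j, t j (Polynomial.X ^ α j)

theorem tensorMap_monomial (t : Fin N → (Polynomial ℂ →ₗ[ℂ] A)) (α : Fin N →₀ ℕ) :
    tensorMap t (MvPolynomial.monomial α 1) = ∏ j, t j (Polynomial.X ^ α j) := by
  have h : MvPolynomial.monomial α (1 : ℂ) = MvPolynomial.basisMonomials (Fin N) ℂ α := by
    rw [MvPolynomial.coe_basisMonomials]
  rw [tensorMap, h, Module.Basis.constr_basis]

theorem tensorMap_prod (t : Fin N → (Polynomial ℂ →ₗ[ℂ] A)) (F : Fin N → Polynomial ℂ) :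
    tensorMap t (∏ j, Polynomial.aeval (MvPolynomial.X j) (F j)) = ∏ j, t j (F j) := by
  set D := Finset.univ.sup (fun j => (F j).natDegree) + 1
  have hD : ∀ j, (F j).natDegree < D := fun j =>
    Nat.lt_succ_iff.mpr (Finset.le_sup (f := fun j => (F j).natDegree) (Finset.mem_univ j))
  have h1 : ∀ j, Polynomial.aeval (MvPolynomial.X j : MvPolynomial (Fin N) ℂ) (F j) =
      ∑ k ∈ Finset.range D, (F j).coeff k • (MvPolynomial.X j : MvPolynomial (Fin N) ℂ) ^ k :=
    fun j => Polynomial.aeval_eq_sum_range' (hD j) _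
  have h2 : ∀ j, t j (F j) =
      ∑ k ∈ Finset.range D, (F j).coeff k • t j (Polynomial.X ^ k) := by
    intro j
    conv_lhs => rw [(F j).as_sum_range' D (hD j), map_sum]
    refine Finset.sum_congr rfl fun k _ => ?_
    rw [← map_smul, Polynomial.smul_X_eq_monomial]
  simp only [h1, h2]
  rw [Finset.prod_univ_sum, Finset.prod_univ_sum, map_sum]
  refine Finset.sum_congr rfl fun α _ => ?_
  have h3 : ∏ j, (MvPolynomial.X j : MvPolynomial (Fin N) ℂ) ^ α j =
      MvPolynomial.monomial (Finsupp.equivFunOnFinite.symm α) 1 := by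
    rw [MvPolynomial.monomial_eq]
    simp [Finsupp.prod_fintype]
  rw [Finset.prod_smul, map_smul, Finset.prod_smul, h3, tensorMap_monomial]
  rfl

/-- The determinant of `F i j (x_j)`. -/
def polyDet (F : Fin N → Fin N → Polynomial ℂ) : MvPolynomial (Fin N) ℂ :=
  Matrix.det (Matrix.of fun i j => Polynomial.aeval (MvPolynomial.X j) (F i j))

/-- Column j involves only x_j, so each Leibniz term is a product of one-variable polynomials. The
functionals take values in an algebra so that this covers coefficient extraction, expectations and
substitution of other polynomials alike. -/
theorem tensorMap_polyDet (t : Fin N → (Polynomial ℂ →ₗ[ℂ] A))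
    (F : Fin N → Fin N → Polynomial ℂ) :
    tensorMap t (polyDet F) = Matrix.det (Matrix.of fun i j => t j (F i j)) := by
  rw [polyDet, Matrix.det_apply, Matrix.det_apply, map_sum]
  refine Finset.sum_congr rfl fun σ _ => ?_
  rw [Units.smul_def, Units.smul_def, map_zsmul]
  congr 1
  exact tensorMap_prod t fun j => F (σ j) j

end tensor

theorem coeff_eq_tensorMap {N : ℕ} (α : Fin N →₀ ℕ) (g : MvPolynomial (Fin N) ℂ) :
    MvPolynomial.coeff α g = tensorMap (fun j => Polynomial.lcoeff ℂ (α j)) g := by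
  suffices h : MvPolynomial.lcoeff ℂ α = tensorMap (fun j => Polynomial.lcoeff ℂ (α j)) by
    rw [← h]; rfl
  refine (MvPolynomial.basisMonomials (Fin N) ℂ).ext fun β => ?_
  rw [MvPolynomial.coe_basisMonomials, tensorMap_monomial]
  simp only [MvPolynomial.lcoeff_apply, Polynomial.lcoeff_apply, Polynomial.coeff_X_pow,
    MvPolynomial.coeff_monomial]
  rw [Finset.prod_ite_zero]
  simp [DFunLike.ext_iff, eq_comm]

theorem coeff_polyDet {N : ℕ} (F : Fin N → Fin N → Polynomial ℂ) (α : Fin N →₀ ℕ) :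
    MvPolynomial.coeff α (polyDet F) = Matrix.det (Matrix.of fun i j => (F i j).coeff (α j)) := by
  rw [coeff_eq_tensorMap, tensorMap_polyDet]
  rfl

/-- Andréief's identity for the product functional `M ⊗ ⋯ ⊗ M`. -/
theorem tensorMap_polyDet_mul_polyDet {N : ℕ} (M : Polynomial ℂ →ₗ[ℂ] ℂ)
    (F G : Fin N → Polynomial ℂ) :
    tensorMap (fun _ => M) (polyDet (fun i _ => F i) * polyDet (fun i _ => G i)) =
      (N.factorial : ℂ) * Matrix.det (Matrix.of fun i j => M (F i * G j)) := by
  -- All N! Leibniz terms of the second determinant contribute equally: permuting the columns by σ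
  -- produces a second sign of σ, which cancels the first.
  have key : ∀ σ : Equiv.Perm (Fin N), tensorMap (fun _ => M) (polyDet (fun i _ => F i) *
      (Equiv.Perm.sign σ • ∏ j, Polynomial.aeval (MvPolynomial.X j) (G (σ j)))) =
      Matrix.det (Matrix.of fun i j => M (F i * G j)) := by
    intro σ
    have h1 : polyDet (fun i _ => F i) *
        ∏ j, Polynomial.aeval (MvPolynomial.X j : MvPolynomial (Fin N) ℂ) (G (σ j)) =
        polyDet (fun i j => F i * G (σ j)) := by
      rw [mul_comm, polyDet, ← Matrix.det_mul_row, polyDet]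
      congr 1
      ext i j : 2
      simp [mul_comm]
    rw [mul_smul_comm, h1, Units.smul_def, map_zsmul, tensorMap_polyDet]
    have h2 := Matrix.det_permute' σ (Matrix.of fun i j => M (F i * G j))
    have h3 : (Matrix.of fun i j => M (F i * G j)).submatrix id σ =
        Matrix.of fun i j => M (F i * G (σ j)) := rfl
    rw [h3] at h2
    rw [h2, zsmul_eq_mul, ← mul_assoc, ← Int.cast_mul, ← Units.val_mul, Int.units_mul_self]
    simp
  conv_lhs => rw [polyDet.eq_def (fun i _ => G i), Matrix.det_apply, Finset.mul_sum, map_sum]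
  simp only [Matrix.of_apply]
  rw [Finset.sum_congr rfl fun σ _ => key σ]
  simp [Finset.card_univ, Fintype.card_perm]

/-! ### Determinants -/

/-- The zero block has N - k rows and k + 1 columns, together more than N, so by the pigeonhole
principle every permutation meets it. This is what confines the expansions below to diagrams
contained in a given one. -/
theorem det_eq_zero_of_block {A : Type*} [CommRing A] {N : ℕ} (W : Matrix (Fin N) (Fin N) A)
    (k : Fin N) (h : ∀ i j, k ≤ i → j ≤ k → W i j = 0) : W.det = 0 := by
  rw [Matrix.det_apply]
  refine Finset.sum_eq_zero fun σ _ => ?_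
  obtain ⟨j, hj, hσ⟩ : ∃ j ≤ k, k ≤ σ j := by
    by_contra! hcon
    have hc := Finset.card_le_card_of_injOn (s := Finset.Iic k) (t := Finset.Iio k) σ
      (fun j hj => by simpa using hcon j (by simpa using hj)) σ.injective.injOn
    simp at hc
  have h0 : ∏ i, W (σ i) i = 0 := Finset.prod_eq_zero (Finset.mem_univ j) (h _ _ hσ hj)
  rw [h0, smul_zero]

/-- The rows from l on are unitriangular, so expansion along the last row removes them one at a
time. It turns N × N determinants into determinants whose size does not depend on N. -/
theorem det_reduce {A : Type*} [CommRing A] (e : ℕ → ℕ → A) {l K : ℕ} (hlK : l ≤ K)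
    (hz : ∀ i j, l ≤ i → j < i → e i j = 0) (h1 : ∀ i, l ≤ i → e i i = 1) :
    Matrix.det (Matrix.of fun i j : Fin K => e i j) =
      Matrix.det (Matrix.of fun i j : Fin l => e i j) := by
  induction K, hlK using Nat.le_induction with
  | base => rfl
  | succ K hK ih =>
    rw [← ih, Matrix.det_succ_row _ (Fin.last K), Fin.sum_univ_castSucc]
    rw [Finset.sum_eq_zero]
    · simp [h1 K hK, Matrix.submatrix, ← two_mul]
    · intro j _
      simp [hz K j hK j.2]

theorem det_ite_strictAnti {A : Type*} [CommRing A] {N : ℕ} {n m : Fin N → ℕ} (hn : StrictAnti n)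
    (hm : StrictAnti m) (h : ℕ → A) :
    Matrix.det (Matrix.of fun i j => if n i = m j then h (n i) else 0) =
      if n = m then ∏ i, h (n i) else 0 := by
  split_ifs with hnm
  · subst hnm
    have : (Matrix.of fun i j => if n i = n j then h (n i) else 0) =
        Matrix.diagonal fun i => h (n i) := by
      ext i j
      simp [Matrix.diagonal_apply, hn.injective.eq_iff]
    rw [this, Matrix.det_diagonal]
  · obtain ⟨i, hi⟩ : ∃ i, ∀ j, n i ≠ m j := by
      by_contra! hcon
      refine hnm ?_
      choose f hf using hcon
      have hfm : StrictMono f := by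
        intro a b hab
        have := hn hab
        rw [hf a, hf b] at this
        exact hm.lt_iff_gt.mp this
      -- A strictly monotone injection of `Fin N` into itself is an order automorphism, and the
      -- identity is the only one.
      have hid : f = id := by
        have := Subsingleton.elim (hfm.orderIsoOfSurjective f
          (Finite.surjective_of_injective hfm.injective)) (OrderIso.refl _)
        funext a
        exact congrArg (fun g : Fin N ≃o Fin N => g a) this
      funext i
      rw [hf i, hid]; rfl
    exact Matrix.det_eq_zero_of_row_eq_zero i fun j => by simp [hi j]

/-! ### Strictly decreasing exponents and Young diagrams -/

/-- The strictly decreasing sequence `μ_i + N - i` (rows counted from `1`). -/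
def shiftedRow (N : ℕ) (mu : YoungDiagram) (i : Fin N) : ℕ := mu.rowLen i + (N - 1 - i)

theorem shiftedRow_strictAnti (N : ℕ) (mu : YoungDiagram) : StrictAnti (shiftedRow N mu) := by
  intro i j hij
  have := mu.rowLen_anti i j (Fin.le_def.mp hij.le)
  have h2 : (i : ℕ) < j := hij
  simp only [shiftedRow]
  omega

theorem rowLen_eq_zero {mu : YoungDiagram} {i : ℕ} : mu.rowLen i = 0 ↔ mu.colLen 0 ≤ i := by
  rw [← not_iff_not, ← ne_eq, ← Nat.pos_iff_ne_zero, ← YoungDiagram.mem_iff_lt_rowLen,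
    YoungDiagram.mem_iff_lt_colLen, not_le]

theorem le_iff_rowLen {mu nu : YoungDiagram} : mu ≤ nu ↔ ∀ i, mu.rowLen i ≤ nu.rowLen i := by
  constructor
  · intro h i
    by_contra! hlt
    have : (i, nu.rowLen i) ∈ nu := h (YoungDiagram.mem_iff_lt_rowLen.mpr hlt)
    exact lt_irrefl _ (YoungDiagram.mem_iff_lt_rowLen.mp this)
  · rintro h ⟨i, j⟩ hij
    exact YoungDiagram.mem_iff_lt_rowLen.mpr
      (lt_of_lt_of_le (YoungDiagram.mem_iff_lt_rowLen.mp hij) (h i))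

theorem eq_of_rowLen {mu nu : YoungDiagram} (h : ∀ i, mu.rowLen i = nu.rowLen i) : mu = nu :=
  le_antisymm (le_iff_rowLen.mpr fun i => (h i).le) (le_iff_rowLen.mpr fun i => (h i).ge)

theorem mem_subdiagrams {l m : YoungDiagram} : m ∈ subdiagrams l ↔ m ≤ l := by
  simp [subdiagrams]

theorem colLen_mono {mu nu : YoungDiagram} (h : mu ≤ nu) : mu.colLen 0 ≤ nu.colLen 0 := by
  rw [← rowLen_eq_zero]
  exact Nat.le_zero.mp ((le_iff_rowLen.mp h _).trans (rowLen_eq_zero.mpr le_rfl).le)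

theorem rowLen_bot (i : ℕ) : (⊥ : YoungDiagram).rowLen i = 0 := by
  by_contra h
  exact YoungDiagram.notMem_bot _ (YoungDiagram.mem_iff_lt_rowLen.mpr (Nat.pos_of_ne_zero h))

theorem colLen_bot : (⊥ : YoungDiagram).colLen 0 = 0 :=
  Nat.le_zero.mp (rowLen_eq_zero.mp (rowLen_bot 0))

theorem subdiagrams_bot : subdiagrams ⊥ = {⊥} := by
  ext m
  simp [mem_subdiagrams]

theorem exists_rowLen_eq {f : ℕ → ℕ} (hf : Antitone f) {N : ℕ} (hN : f N = 0) :
    ∃ mu : YoungDiagram, ∀ i, mu.rowLen i = f i := by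
  refine ⟨⟨(Finset.range N ×ˢ Finset.range (f 0)).filter fun c => c.2 < f c.1, ?_⟩, fun i => ?_⟩
  · rintro ⟨a, b⟩ ⟨a', b'⟩ hle hab
    obtain ⟨ha, hb⟩ := Prod.mk_le_mk.mp hle
    simp only [Finset.coe_filter, Finset.mem_product, Finset.mem_range, Set.mem_ofPred_eq] at hab ⊢
    have := hf ha
    omega
  · refine eq_of_forall_lt_iff fun j => ?_
    rw [← YoungDiagram.mem_iff_lt_rowLen, ← YoungDiagram.mem_cells]
    simp only [Finset.mem_filter, Finset.mem_product, Finset.mem_range]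
    refine ⟨fun h => h.2, fun h => ⟨⟨?_, lt_of_lt_of_le h (hf (Nat.zero_le i))⟩, h⟩⟩
    by_contra! hle
    have := hf hle
    omega

theorem exists_shiftedRow_eq {N : ℕ} {α : Fin N → ℕ} (hα : StrictAnti α) :
    ∃ mu : YoungDiagram, mu.colLen 0 ≤ N ∧ shiftedRow N mu = α := by
  have hstep : ∀ i (h : i + 1 < N), α ⟨i + 1, h⟩ < α ⟨i, by omega⟩ := fun i h =>
    hα (Fin.mk_lt_mk.mpr (Nat.lt_succ_self i))
  -- Strict decrease forces α_i ≥ N - 1 - i, so the truncated subtraction that defines the rows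
  -- loses nothing.
  have hge : ∀ k i (h : i < N), N - 1 - i = k → k ≤ α ⟨i, h⟩ := by
    intro k
    induction k with
    | zero => intros; omega
    | succ k ih =>
      intro i h hk
      have := ih (i + 1) (by omega) (by omega)
      have := hstep i (by omega)
      omega
  obtain ⟨mu, hmu⟩ := exists_rowLen_eq
    (f := fun i => if h : i < N then α ⟨i, h⟩ - (N - 1 - i) else 0) (N := N)
    (antitone_nat_of_succ_le fun i => by
      by_cases h : i + 1 < N
      · have := hstep i h
        simp only [h, dif_pos, show i < N by omega]
        omega
      · simp [h]) (by simp)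
  refine ⟨mu, ?_, ?_⟩
  · rw [← rowLen_eq_zero, hmu]; simp
  · funext i
    have := hge _ i i.2 rfl
    simp only [shiftedRow, hmu, i.2, dif_pos]
    simp only [Fin.eta] at this ⊢
    omega

theorem shiftedRow_injective {N : ℕ} {mu nu : YoungDiagram} (hmu : mu.colLen 0 ≤ N)
    (hnu : nu.colLen 0 ≤ N) (h : shiftedRow N mu = shiftedRow N nu) : mu = nu := by
  refine eq_of_rowLen fun i => ?_
  by_cases hi : i < N
  · have := congrFun h ⟨i, hi⟩
    simp only [shiftedRow] at this
    omega
  · rw [rowLen_eq_zero.mpr (by omega), rowLen_eq_zero.mpr (by omega)]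

/-! ### Alternating polynomials -/

theorem rename_polyDet {N : ℕ} (F : Fin N → Polynomial ℂ) (σ : Equiv.Perm (Fin N)) :
    MvPolynomial.rename σ (polyDet fun i _ => F i) =
      ((Equiv.Perm.sign σ : ℤ) : MvPolynomial (Fin N) ℂ) * polyDet fun i _ => F i := by
  rw [polyDet, ← Matrix.det_permute', ← AlgHom.coe_toRingHom, RingHom.map_det]
  congr 1
  ext i j : 2
  simp [← Polynomial.aeval_algHom_apply]

/-- Permuting an exponent changes the coefficient only by a sign. Distinct exponents can be sorted
into decreasing order; if two agree, their transposition makes the coefficient equal to its own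
negative. -/
theorem eq_zero_of_alternating {N : ℕ} {g : MvPolynomial (Fin N) ℂ}
    (hg : ∀ σ : Equiv.Perm (Fin N), MvPolynomial.rename σ g =
      ((Equiv.Perm.sign σ : ℤ) : MvPolynomial (Fin N) ℂ) * g)
    (h0 : ∀ α : Fin N →₀ ℕ, StrictAnti α → MvPolynomial.coeff α g = 0) : g = 0 := by
  have hc : ∀ (σ : Equiv.Perm (Fin N)) (α : Fin N →₀ ℕ),
      MvPolynomial.coeff α g =
        ((Equiv.Perm.sign σ : ℤ) : ℂ) * MvPolynomial.coeff (α.mapDomain σ) g := by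
    intro σ α
    rw [← MvPolynomial.coeff_rename_mapDomain σ σ.injective g α, hg, ← zsmul_eq_mul,
      MvPolynomial.coeff_smul, zsmul_eq_mul]
  have happ : ∀ (σ : Equiv.Perm (Fin N)) (α : Fin N →₀ ℕ) (i : Fin N),
      α.mapDomain σ i = α (σ⁻¹ i) := by
    intro σ α i
    rw [← Finsupp.equivMapDomain_eq_mapDomain, Finsupp.equivMapDomain_apply]; rfl
  ext α
  rw [MvPolynomial.coeff_zero]
  by_cases hinj : Function.Injective α
  · set σ := Tuple.sort (fun i => OrderDual.toDual (α i))
    have hm : Monotone ((fun i => OrderDual.toDual (α i)) ∘ σ) := Tuple.monotone_sort _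
    rw [hc σ⁻¹ α, h0, mul_zero]
    have hs := hm.strictMono_of_injective
      ((OrderDual.toDual.injective.comp hinj).comp σ.injective)
    intro i j hij
    rw [happ, happ, inv_inv]
    exact hs hij
  · obtain ⟨i, j, hij, hne⟩ : ∃ i j, α i = α j ∧ i ≠ j := by
      simpa [Function.Injective] using hinj
    have h := hc (Equiv.swap i j) α
    have hfix : α.mapDomain (Equiv.swap i j) = α := by
      ext k
      rw [happ, Equiv.swap_inv, Equiv.swap_apply_def]
      split_ifs with h1 h2
      · rw [h1, hij]
      · rw [h2, hij]
      · rfl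
    rw [hfix, Equiv.Perm.sign_swap hne] at h
    simp only [Units.val_neg, Units.val_one, Int.cast_neg, Int.cast_one, neg_mul, one_mul] at h
    exact self_eq_neg.mp h

/-- The alternant with exponents `shiftedRow N mu`. -/
def monomialAlternant (N : ℕ) (mu : YoungDiagram) : MvPolynomial (Fin N) ℂ :=
  polyDet fun i _ => Polynomial.X ^ shiftedRow N mu i

theorem coeff_monomialAlternant {N : ℕ} (mu : YoungDiagram) {α : Fin N →₀ ℕ} (hα : StrictAnti α) :
    MvPolynomial.coeff α (monomialAlternant N mu) = if shiftedRow N mu = α then 1 else 0 := by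
  rw [monomialAlternant, coeff_polyDet]
  have := det_ite_strictAnti (shiftedRow_strictAnti N mu) hα (fun _ => (1 : ℂ))
  simp only [Finset.prod_const_one] at this
  rw [← this]
  congr 1
  ext i j
  simp [Polynomial.coeff_X_pow, eq_comm]

/-- Expansion of an alternating polynomial in monomial alternants. -/
theorem eq_sum_monomialAlternant {N : ℕ} {g : MvPolynomial (Fin N) ℂ}
    (hg : ∀ σ : Equiv.Perm (Fin N), MvPolynomial.rename σ g =
      ((Equiv.Perm.sign σ : ℤ) : MvPolynomial (Fin N) ℂ) * g)
    (S : Finset YoungDiagram) (hS : ∀ nu ∈ S, nu.colLen 0 ≤ N)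
    (h0 : ∀ nu : YoungDiagram, nu.colLen 0 ≤ N → nu ∉ S →
      MvPolynomial.coeff (Finsupp.equivFunOnFinite.symm (shiftedRow N nu)) g = 0) :
    g = ∑ nu ∈ S, MvPolynomial.coeff (Finsupp.equivFunOnFinite.symm (shiftedRow N nu)) g •
      monomialAlternant N nu := by
  rw [← sub_eq_zero]
  refine eq_zero_of_alternating (fun σ => ?_) fun α hα => ?_
  · rw [map_sub, hg, map_sum, mul_sub, Finset.mul_sum]
    congr 1
    refine Finset.sum_congr rfl fun nu _ => ?_
    rw [map_smul, monomialAlternant, rename_polyDet, mul_smul_comm]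
  · obtain ⟨nu, hnu, hnuα⟩ := exists_shiftedRow_eq hα
    have hα' : Finsupp.equivFunOnFinite.symm (shiftedRow N nu) = α := by
      ext i; simp [hnuα]
    rw [MvPolynomial.coeff_sub, MvPolynomial.coeff_sum, sub_eq_zero]
    simp only [MvPolynomial.coeff_smul, coeff_monomialAlternant _ hα, smul_eq_mul, mul_ite, mul_one,
      mul_zero]
    by_cases hmem : nu ∈ S
    · rw [Finset.sum_eq_single nu, if_pos hnuα, hα']
      · intro rho hrho hne
        rw [if_neg]
        intro h
        exact hne (shiftedRow_injective (hS rho hrho) hnu (h.trans hnuα.symm))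
      · exact fun h => absurd hmem h
    · rw [← hα', h0 nu hnu hmem, Finset.sum_eq_zero]
      intro rho hrho
      rw [if_neg]
      intro h
      refine hmem ?_
      have h' : shiftedRow N rho = shiftedRow N nu := by rw [h]; rfl
      rwa [← shiftedRow_injective (hS rho hrho) hnu h']

/-- A form of the Cauchy–Binet identity for triangular families of polynomials. -/
theorem det_eq_sum_det {N : ℕ} {A : Type*} [CommRing A] [Algebra ℂ A] {mu : YoungDiagram}
    (hmu : mu.colLen 0 ≤ N) (G : ℕ → Polynomial ℂ) (hG : ∀ n, (G n).natDegree ≤ n)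
    (t : Fin N → (Polynomial ℂ →ₗ[ℂ] A)) :
    Matrix.det (Matrix.of fun i j => t j (G (shiftedRow N mu i))) =
      ∑ nu ∈ subdiagrams mu,
        Matrix.det (Matrix.of fun i j => (G (shiftedRow N mu i)).coeff (shiftedRow N nu j)) •
          Matrix.det (Matrix.of fun i j => t j (Polynomial.X ^ shiftedRow N nu i)) := by
  have h := eq_sum_monomialAlternant (g := polyDet fun i _ => G (shiftedRow N mu i))
    (rename_polyDet _) (subdiagrams mu)
    (fun nu hnu => (colLen_mono (mem_subdiagrams.mp hnu)).trans hmu) (by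
      intro nu hnu hnot
      rw [mem_subdiagrams, le_iff_rowLen] at hnot
      push Not at hnot
      obtain ⟨k, hk⟩ := hnot
      have hkN : k < N := by
        by_contra! hle
        rw [rowLen_eq_zero.mpr (hnu.trans hle)] at hk
        omega
      rw [coeff_polyDet]
      -- If ν_k > μ_k, then for i ≥ k ≥ j the exponent belonging to ν_j exceeds the degree allowed
      -- by μ_i, which produces the zero block.
      refine det_eq_zero_of_block _ ⟨k, hkN⟩ fun i j hi hj => ?_
      refine Polynomial.coeff_eq_zero_of_natDegree_lt (lt_of_le_of_lt (hG _) ?_)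
      have h1 := (shiftedRow_strictAnti N mu).antitone hi
      have h2 := (shiftedRow_strictAnti N nu).antitone hj
      simp only [Finsupp.equivFunOnFinite_symm_apply_apply]
      simp only [shiftedRow] at h1 h2 ⊢
      omega)
  -- The expansion holds in the universal case of independent variables x_j; applying `tensorMap t`
  -- specialises it.
  have h2 := congrArg (tensorMap t) h
  rw [tensorMap_polyDet, map_sum] at h2
  rw [h2]
  refine Finset.sum_congr rfl fun nu _ => ?_
  rw [map_smul, monomialAlternant, tensorMap_polyDet, coeff_polyDet]
  rfl

theorem vandermonde_eq_monomialAlternant (N : ℕ) : vandermonde N = monomialAlternant N ⊥ := by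
  -- Exponents decrease along the alternant but increase in `Matrix.vandermonde`. Reversing rows and
  -- columns simultaneously reconciles them without changing the determinant.
  have h1 : monomialAlternant N ⊥ = ((Matrix.vandermonde fun i : Fin N =>
      (MvPolynomial.X i.rev : MvPolynomial (Fin N) ℂ)).submatrix Fin.revPerm
        Fin.revPerm).transpose.det := by
    rw [monomialAlternant, polyDet]
    congr 1
    ext i j : 2
    simp [Matrix.vandermonde, shiftedRow, rowLen_bot, Fin.val_rev, Nat.sub_sub, add_comm]
  rw [h1, Matrix.det_transpose, Matrix.det_submatrix_equiv_self, Matrix.det_vandermonde,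
    Finset.prod_sigma', vandermonde]
  refine Finset.prod_bij' (fun p _ => (⟨p.2.rev, p.1.rev⟩ : (_ : Fin N) × Fin N))
    (fun s _ => (s.2.rev, s.1.rev)) ?_ ?_ ?_ ?_ ?_ <;> simp

theorem vandermonde_ne_zero (N : ℕ) : vandermonde N ≠ 0 := by
  refine Finset.prod_ne_zero_iff.mpr fun p hp => ?_
  exact (irreducible_X_sub_X (Finset.mem_filter.mp hp).2.ne).ne_zero

/-! ### Statistics of Young diagrams -/

theorem sum_cells {A : Type*} [AddCommMonoid A] (mu : YoungDiagram) (f : ℕ × ℕ → A) {N : ℕ}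
    (hN : mu.colLen 0 ≤ N) :
    ∑ c ∈ mu.cells, f c = ∑ i ∈ Finset.range N, ∑ j ∈ Finset.range (mu.rowLen i), f (i, j) := by
  rw [Finset.sum_sigma']
  refine Finset.sum_bij' (fun c _ => (⟨c.1, c.2⟩ : (_ : ℕ) × ℕ)) (fun s _ => (s.1, s.2)) ?_ ?_
    ?_ ?_ ?_
  · rintro ⟨i, j⟩ hc
    have h := YoungDiagram.mem_iff_lt_rowLen.mp (mu.mem_cells _ |>.mp hc)
    simp only [Finset.mem_sigma, Finset.mem_range]
    refine ⟨?_, h⟩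
    by_contra! hle
    rw [rowLen_eq_zero.mpr (hN.trans hle)] at h
    omega
  · rintro ⟨i, j⟩ hs
    simp only [Finset.mem_sigma, Finset.mem_range] at hs
    exact mu.mem_cells _ |>.mpr (YoungDiagram.mem_iff_lt_rowLen.mpr hs.2)
  all_goals simp

theorem card_eq_sum_rowLen (mu : YoungDiagram) {N : ℕ} (hN : mu.colLen 0 ≤ N) :
    mu.card = ∑ i : Fin N, mu.rowLen i := by
  rw [YoungDiagram.card, Finset.card_eq_sum_ones, sum_cells mu _ hN,
    Fin.sum_univ_eq_sum_range (fun i => mu.rowLen i)]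
  simp

theorem nStat_eq_sum (mu : YoungDiagram) {N : ℕ} (hN : mu.colLen 0 ≤ N) :
    nStat mu = ∑ i : Fin N, (i : ℤ) * (mu.rowLen i : ℤ) := by
  have key : ∀ {K : ℕ}, mu.colLen 0 ≤ K →
      ∑ i ∈ Finset.range K, (i : ℤ) * (mu.rowLen i : ℤ) = ∑ c ∈ mu.cells, (c.1 : ℤ) := by
    intro K hK
    rw [sum_cells mu _ hK]
    refine Finset.sum_congr rfl fun i _ => ?_
    simp [mul_comm]
  rw [nStat, key le_rfl, Fin.sum_univ_eq_sum_range (fun i => (i : ℤ) * (mu.rowLen i : ℤ)), key hN]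

theorem nStat_transpose_eq_sum (mu : YoungDiagram) {N : ℕ} (hN : mu.colLen 0 ≤ N) :
    nStat mu.transpose = ∑ i : Fin N, ((mu.rowLen i).choose 2 : ℤ) := by
  have h1 : nStat mu.transpose = ∑ c ∈ mu.transpose.cells, (c.1 : ℤ) := by
    rw [nStat, sum_cells _ _ le_rfl]
    refine Finset.sum_congr rfl fun i _ => ?_
    simp [mul_comm]
  have h2 : ∑ c ∈ mu.transpose.cells, (c.1 : ℤ) = ∑ c ∈ mu.cells, (c.2 : ℤ) := by
    refine Finset.sum_bij' (fun c _ => c.swap) (fun c _ => c.swap) ?_ ?_ ?_ ?_ ?_ <;>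
      simp [YoungDiagram.mem_transpose]
  rw [h1, h2, sum_cells mu _ hN, Fin.sum_univ_eq_sum_range (fun i => ((mu.rowLen i).choose 2 : ℤ))]
  refine Finset.sum_congr rfl fun i _ => ?_
  have : (∑ j ∈ Finset.range (mu.rowLen i), j) = (mu.rowLen i).choose 2 := by
    rw [Finset.sum_range_id, Nat.choose_two_right]
  exact_mod_cast this

theorem sum_shiftedRow (mu : YoungDiagram) {N : ℕ} (hN : mu.colLen 0 ≤ N) :
    ∑ i, shiftedRow N mu i = mu.card + ∑ i : Fin N, (N - 1 - (i : ℕ)) := by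
  rw [card_eq_sum_rowLen mu hN, ← Finset.sum_add_distrib]
  rfl

/-- Apply C(a+b, 2) = C(a, 2) + C(b, 2) + ab with a = μ_i and b = N - 1 - i. This is the source of
n(μ') - n(μ) in all powers of q, and its N-dependence is only a multiple of |μ|. -/
theorem sum_choose_shiftedRow (mu : YoungDiagram) {N : ℕ} (hN : mu.colLen 0 ≤ N) :
    (∑ i, ((shiftedRow N mu i).choose 2 : ℤ)) =
      (nStat mu.transpose - nStat mu + ((N : ℤ) - 1) * mu.card) +
        ∑ i : Fin N, ((N - 1 - (i : ℕ)).choose 2 : ℤ) := by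
  rw [nStat_eq_sum mu hN, nStat_transpose_eq_sum mu hN, card_eq_sum_rowLen mu hN, Nat.cast_sum,
    Finset.mul_sum, ← Finset.sum_sub_distrib, ← Finset.sum_add_distrib, ← Finset.sum_add_distrib]
  refine Finset.sum_congr rfl fun i _ => ?_
  rw [shiftedRow, choose_two_add]
  have h : ((N - 1 - (i : ℕ) : ℕ) : ℤ) = (N : ℤ) - 1 - i := by omega
  push_cast [h]
  ring

theorem colLen_le_card (mu : YoungDiagram) : mu.colLen 0 ≤ mu.card := by
  rw [YoungDiagram.colLen_eq_card]; exact Finset.card_le_card (Finset.filter_subset _ _)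

theorem finite_card_le (D : ℕ) : {mu : YoungDiagram | mu.card ≤ D}.Finite := by
  refine Set.Finite.of_finite_image (f := YoungDiagram.cells) ?_
    (fun _ _ _ _ h => YoungDiagram.ext h)
  refine (Finset.finite_toSet (Finset.range D ×ˢ Finset.range D).powerset).subset ?_
  rintro _ ⟨mu, hmu, rfl⟩
  rw [Finset.mem_coe, Finset.mem_powerset]
  rintro ⟨i, j⟩ hij
  have hij' := mu.mem_cells _ |>.mp hij
  have h1 : i < mu.colLen 0 :=
    YoungDiagram.mem_iff_lt_colLen.mp (mu.up_left_mem le_rfl (Nat.zero_le j) hij')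
  have h2 : j < mu.rowLen 0 :=
    YoungDiagram.mem_iff_lt_rowLen.mp (mu.up_left_mem (Nat.zero_le i) le_rfl hij')
  have h3 := colLen_le_card mu
  have h4 : mu.rowLen 0 ≤ mu.card := by
    rw [YoungDiagram.rowLen_eq_card]; exact Finset.card_le_card (Finset.filter_subset _ _)
  have h5 : mu.card ≤ D := hmu
  simp only [Finset.mem_product, Finset.mem_range]
  omega

/-! ### Products of `q`-Pochhammer symbols along rows -/

theorem prod_rows {A : Type*} [CommMonoid A] (mu : YoungDiagram) {N : ℕ} (hN : mu.colLen 0 ≤ N)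
    (f : ℕ → A) (hf : ∀ i, mu.rowLen i = 0 → f i = 1) :
    ∏ i : Fin N, f i = ∏ i ∈ Finset.range (mu.colLen 0), f i := by
  rw [Fin.prod_univ_eq_prod_range]
  refine (Finset.prod_subset (Finset.range_mono hN) fun i _ hi => hf i ?_).symm
  exact rowLen_eq_zero.mpr (by simpa using hi)

/-- Splitting off the first N - 1 - i factors moves the base from x q^{1-N} to x q^{-i}, which is
the base that row i has in (x;q)_μ. -/
theorem prod_qPoch_shiftedRow {q : ℂ} (hq : q ≠ 0) (x : ℂ) (mu : YoungDiagram) {N : ℕ}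
    (hN : mu.colLen 0 ≤ N) :
    ∏ i, qPoch (x * q ^ (1 - (N : ℤ))) q (shiftedRow N mu i) =
      qPochPartition x q mu * ∏ i : Fin N, qPoch (x * q ^ (1 - (N : ℤ))) q (N - 1 - (i : ℕ)) := by
  rw [qPochPartition, ← prod_rows mu hN _ fun i hi => by rw [hi, qPoch_zero],
    ← Finset.prod_mul_distrib]
  refine Finset.prod_congr rfl fun i _ => ?_
  rw [shiftedRow, add_comm, qPoch_add, mul_comm]
  congr 2
  rw [mul_assoc, ← zpow_natCast, ← zpow_add₀ hq]
  congr 2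
  omega

/-- The ratio `∏ (q; q)_{μ_i + N - i} / (q; q)_{N - i}`. -/
def rowRatio (q : ℂ) (N : ℕ) (mu : YoungDiagram) : ℂ :=
  ∏ i : Fin N, qPoch q q (shiftedRow N mu i) / qPoch q q (N - 1 - (i : ℕ))

theorem rowRatio_ne_zero {q : ℂ} (hw : ∀ n, qPoch q q n ≠ 0) (N : ℕ) (mu : YoungDiagram) :
    rowRatio q N mu ≠ 0 :=
  Finset.prod_ne_zero_iff.mpr fun _ _ => div_ne_zero (hw _) (hw _)

/-- Only the nonempty rows contribute, and each contributes (q^{N-i};q)_{μ_i}, which tends to 1. -/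
theorem tendsto_rowRatio {q : ℂ} (hw : ∀ n, qPoch q q n ≠ 0) (hq1 : ‖q‖ < 1) (mu : YoungDiagram) :
    Tendsto (fun N => rowRatio q N mu) atTop (𝓝 1) := by
  have h1 : ∀ᶠ N in atTop, ∏ i ∈ Finset.range (mu.colLen 0),
      qPoch (q * q ^ (N - 1 - i)) q (mu.rowLen i) = rowRatio q N mu := by
    filter_upwards [eventually_ge_atTop (mu.colLen 0)] with N hN
    rw [← prod_rows mu hN (fun i => qPoch (q * q ^ (N - 1 - i)) q (mu.rowLen i))
      fun i hi => by rw [hi, qPoch_zero], rowRatio]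
    refine Finset.prod_congr rfl fun i _ => ?_
    rw [shiftedRow, add_comm, qPoch_add, mul_div_cancel_left₀ _ (hw _)]
  refine Tendsto.congr' h1 ?_
  have h2 : ∀ i ∈ Finset.range (mu.colLen 0), Tendsto (fun N : ℕ =>
      qPoch (q * q ^ (N - 1 - i)) q (mu.rowLen i)) atTop (𝓝 1) := by
    intro i _
    have h3 : Tendsto (fun N : ℕ => q ^ (N - 1 - i)) atTop (𝓝 0) := by
      refine (tendsto_pow_atTop_nhds_zero_of_norm_lt_one hq1).comp ?_
      simp only [Nat.sub_sub]
      exact tendsto_sub_atTop_nat _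
    have h4 : Tendsto (fun N : ℕ => ∏ k ∈ Finset.range (mu.rowLen i),
        (1 - q * q ^ (N - 1 - i) * q ^ k)) atTop (𝓝 (∏ k ∈ Finset.range (mu.rowLen i),
        (1 - q * 0 * q ^ k))) :=
      tendsto_finsetProd _ fun k _ => ((h3.const_mul q).mul_const _).const_sub 1
    simpa [qPoch] using h4
  simpa using tendsto_finsetProd _ h2

/-! ### Positivity for admissible parameters -/

/-- For conjugate parameters the product is a squared modulus, nonzero because c is not real. In the
second case c/a and d/a lie strictly between the same consecutive powers of q, so both factors have
the same sign. For negative parameters both factors exceed 1. -/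
theorem IsAdmissible.exists_factor_pos {q a : ℝ} {c d : ℂ} (hq0 : 0 < q) (hq1 : q < 1)
    (h : IsAdmissible q a c d) (k : ℤ) :
    ∃ r : ℝ, 0 < r ∧ (1 - c / a * (q : ℂ) ^ k) * (1 - d / a * (q : ℂ) ^ k) = r := by
  obtain ⟨ha, h⟩ := h
  have hqk : 0 < q ^ k := zpow_pos hq0 k
  rcases h with ⟨hc, rfl⟩ | ⟨c, d, rfl, rfl, m, ⟨hc1, hc2⟩, hd1, hd2⟩ | ⟨c, d, rfl, rfl, hc, hd, -⟩
  · set z : ℂ := 1 - c / a * (q : ℂ) ^ k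
    have hz : (1 - (starRingEnd ℂ) c / a * (q : ℂ) ^ k) = (starRingEnd ℂ) z := by
      simp [z, map_zpow₀]
    refine ⟨Complex.normSq z, Complex.normSq_pos.mpr fun h0 => hc ?_, ?_⟩
    · have h1 : c * ((q ^ k / a : ℝ) : ℂ) = 1 := by
        push_cast
        linear_combination -h0
      have h2 := congrArg Complex.im h1
      simp only [Complex.mul_im, Complex.ofReal_im, Complex.ofReal_re, mul_zero, zero_add,
        Complex.one_im] at h2
      exact (mul_eq_zero.mp h2).resolve_right (div_pos hqk ha).ne'
    · rw [hz, Complex.mul_conj]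
  · refine ⟨(1 - c / a * q ^ k) * (1 - d / a * q ^ k), ?_, by push_cast; ring⟩
    rcases le_or_gt k (-m) with hk | hk
    · have hm : ∀ x : ℝ, a * q ^ m < x → 1 - x / a * q ^ k < 0 := by
        intro x hx
        have h1 : 1 ≤ q ^ m * q ^ k := by
          rw [← zpow_add₀ hq0.ne']
          exact one_le_zpow_of_nonpos₀ hq0 hq1.le (by omega)
        have h2 : q ^ m < x / a := by rw [lt_div_iff₀ ha, mul_comm]; exact hx
        nlinarith [mul_lt_mul_of_pos_right h2 hqk]
      exact mul_pos_of_neg_of_neg (hm c hc1) (hm d hd1)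
    · have hm : ∀ x : ℝ, x < a * q ^ (m - 1) → 0 < 1 - x / a * q ^ k := by
        intro x hx
        have h1 : q ^ (m - 1) * q ^ k ≤ 1 := by
          rw [← zpow_add₀ hq0.ne']
          exact zpow_le_one₀ hq0 hq1.le (by omega)
        have h2 : x / a < q ^ (m - 1) := by rw [div_lt_iff₀ ha, mul_comm]; exact hx
        nlinarith [mul_lt_mul_of_pos_right h2 hqk]
      exact mul_pos (hm c hc2) (hm d hd2)
  · refine ⟨(1 - c / a * q ^ k) * (1 - d / a * q ^ k), ?_, by push_cast; ring⟩
    have hm : ∀ x : ℝ, x < 0 → 0 < 1 - x / a * q ^ k := by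
      intro x hx
      have := mul_neg_of_neg_of_pos (div_neg_of_neg_of_pos hx ha) hqk
      linarith
    exact mul_pos (hm c hc) (hm d hd)

theorem IsAdmissible.exists_mul_pos {q a : ℝ} {c d : ℂ} (hq0 : 0 < q)
    (h : IsAdmissible q a c d) : ∃ r : ℝ, 0 < r ∧ c * d = r := by
  obtain ⟨ha, h⟩ := h
  rcases h with ⟨hc, rfl⟩ | ⟨c, d, rfl, rfl, m, ⟨hc1, -⟩, hd1, -⟩ | ⟨c, d, rfl, rfl, hc, hd, -⟩
  · refine ⟨Complex.normSq c, Complex.normSq_pos.mpr fun h0 => hc (by simp [h0]), ?_⟩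
    rw [Complex.mul_conj]
  · have : 0 < a * q ^ m := mul_pos ha (zpow_pos hq0 m)
    exact ⟨c * d, mul_pos (this.trans hc1) (this.trans hd1), by push_cast; rfl⟩
  · exact ⟨c * d, mul_pos_of_neg_of_neg hc hd, by push_cast; rfl⟩

theorem exists_prod_pos {ι : Type*} (s : Finset ι) (f : ι → ℂ)
    (h : ∀ i ∈ s, ∃ r : ℝ, 0 < r ∧ f i = r) : ∃ r : ℝ, 0 < r ∧ ∏ i ∈ s, f i = r := by
  choose! r hr hf using h
  refine ⟨∏ i ∈ s, r i, Finset.prod_pos hr, ?_⟩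
  rw [Complex.ofReal_prod]
  exact Finset.prod_congr rfl hf

theorem normSqMeixner_pos {q a : ℝ} {c d : ℂ} (hq0 : 0 < q) (hq1 : q < 1)
    (h : IsAdmissible q a c d) (l : YoungDiagram) :
    ∃ r : ℝ, 0 < r ∧ normSqMeixner q a c d l = r := by
  have hqc : (q : ℂ) ≠ 0 := by exact_mod_cast hq0.ne'
  obtain ⟨r, hr, hcd⟩ := h.exists_mul_pos hq0
  obtain ⟨s, hs, hprod⟩ : ∃ s : ℝ, 0 < s ∧
      qPochPartition (c * q / a) q l * qPochPartition (d * q / a) q l = s := by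
    rw [qPochPartition, qPochPartition, ← Finset.prod_mul_distrib]
    refine exists_prod_pos _ _ fun i _ => ?_
    rw [qPoch, qPoch, ← Finset.prod_mul_distrib]
    refine exists_prod_pos _ _ fun k _ => ?_
    obtain ⟨t, ht, hfac⟩ := h.exists_factor_pos hq0 hq1 (1 - i + k)
    refine ⟨t, ht, ?_⟩
    have e : (q : ℂ) ^ (1 - (i : ℤ) + k) = q * (q : ℂ) ^ (-(i : ℤ)) * (q : ℂ) ^ k := by
      rw [← zpow_natCast, ← zpow_one_add₀ hqc, ← zpow_add₀ hqc, sub_eq_add_neg]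
    rw [← hfac, e]
    ring
  refine ⟨q ^ (4 * (nStat l - nStat l.transpose)) * (a ^ 2 / (r ^ 2 * q ^ 3)) ^ l.card * s, ?_, ?_⟩
  · have := h.1
    positivity
  · rw [normSqMeixner, hprod, ← mul_pow c d, hcd]
    push_cast
    rfl

/-! ### Restriction of symmetric functions to finitely many variables -/

theorem coeff_mapDomain_perm (f : SymFun) (e : Equiv.Perm ℕ) (α : ℕ →₀ ℕ) :
    MvPowerSeries.coeff (α.mapDomain e) (f : MvPowerSeries ℕ ℂ) =
      MvPowerSeries.coeff α (f : MvPowerSeries ℕ ℂ) := by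
  have h := MvPowerSeries.coeff_embDomain_rename e.toEmbedding (f : MvPowerSeries ℕ ℂ) α
  rw [Finsupp.embDomain_eq_mapDomain] at h
  have h2 : MvPowerSeries.rename e.toEmbedding (f : MvPowerSeries ℕ ℂ) = f := f.2.2 e
  rw [h2] at h
  exact h

theorem exists_restrict (N : ℕ) (f : SymFun) : ∃ p : MvPolynomial (Fin N) ℂ,
    (p : MvPowerSeries (Fin N) ℂ) =
      MvPowerSeries.killCompl Fin.valEmbedding (f : MvPowerSeries ℕ ℂ) := by
  classical
  obtain ⟨D, hD⟩ := f.2.1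
  refine ⟨∑ α ∈ (Finsupp.finite_of_degree_le (σ := Fin N) D).toFinset, MvPolynomial.monomial α
    (MvPowerSeries.coeff (Finsupp.embDomain Fin.valEmbedding α) (f : MvPowerSeries ℕ ℂ)), ?_⟩
  ext α
  rw [MvPolynomial.coeff_coe, MvPolynomial.coeff_sum, MvPowerSeries.coeff_killCompl]
  simp only [MvPolynomial.coeff_monomial]
  rw [Finset.sum_ite_eq']
  split_ifs with h
  · rfl
  · refine (hD _ ?_).symm
    rw [Finsupp.embDomain_eq_mapDomain, Finsupp.degree_mapDomain]
    simpa using h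

/-- The symmetric polynomial `f(x_1, …, x_N, 0, 0, …)`. -/
def restrict (N : ℕ) : SymFun →ₐ[ℂ] MvPolynomial (Fin N) ℂ where
  toFun f := (exists_restrict N f).choose
  map_one' := by
    apply MvPolynomial.coe_injective
    rw [(exists_restrict N 1).choose_spec]
    simp
  map_mul' f g := by
    apply MvPolynomial.coe_injective
    rw [MvPolynomial.coe_mul]
    simp only [(exists_restrict N _).choose_spec]
    simp
  map_zero' := by
    apply MvPolynomial.coe_injective
    rw [(exists_restrict N 0).choose_spec]
    simp
  map_add' f g := by
    apply MvPolynomial.coe_injective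
    rw [MvPolynomial.coe_add]
    simp only [(exists_restrict N _).choose_spec]
    simp
  commutes' r := by
    apply MvPolynomial.coe_injective
    rw [(exists_restrict N _).choose_spec, MvPolynomial.algebraMap_eq, MvPolynomial.coe_C]
    change MvPowerSeries.killCompl _ (algebraMap ℂ (MvPowerSeries ℕ ℂ) r) = _
    rw [MvPowerSeries.algebraMap_apply]
    simp

theorem coeff_restrict {N : ℕ} (f : SymFun) (α : Fin N →₀ ℕ) :
    MvPolynomial.coeff α (restrict N f) =
      MvPowerSeries.coeff (α.mapDomain Fin.val) (f : MvPowerSeries ℕ ℂ) := by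
  rw [← MvPolynomial.coeff_coe]
  change MvPowerSeries.coeff α
    ((exists_restrict N f).choose : MvPowerSeries (Fin N) ℂ) = _
  rw [(exists_restrict N f).choose_spec, MvPowerSeries.coeff_killCompl,
    Finsupp.embDomain_eq_mapDomain]
  rfl

theorem exists_mapDomain_val {N : ℕ} {α : ℕ →₀ ℕ} (h : ∀ i ∈ α.support, i < N) :
    ∃ β : Fin N →₀ ℕ, β.mapDomain Fin.val = α := by
  refine ⟨α.comapDomain Fin.val Fin.val_injective.injOn, ?_⟩
  refine Finsupp.mapDomain_comapDomain _ Fin.val_injective _ fun i hi => ?_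
  exact ⟨⟨i, h i hi⟩, rfl⟩

theorem coeff_rename_restrict {N : ℕ} (f : SymFun) {α : ℕ →₀ ℕ} (h : ∀ i ∈ α.support, i < N) :
    MvPolynomial.coeff α (MvPolynomial.rename Fin.val (restrict N f)) =
      MvPowerSeries.coeff α (f : MvPowerSeries ℕ ℂ) := by
  obtain ⟨β, rfl⟩ := exists_mapDomain_val h
  rw [MvPolynomial.coeff_rename_mapDomain _ Fin.val_injective, coeff_restrict]

theorem tendsto_coeff_rename_restrict (f : SymFun) (α : ℕ →₀ ℕ) :
    Tendsto (fun N => MvPolynomial.coeff α (MvPolynomial.rename Fin.val (restrict N f))) atTop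
      (𝓝 (MvPowerSeries.coeff α (f : MvPowerSeries ℕ ℂ))) := by
  refine tendsto_const_nhds.congr' ?_
  filter_upwards [eventually_gt_atTop (α.support.sup id)] with N hN
  refine (coeff_rename_restrict f fun i hi => ?_).symm
  exact lt_of_le_of_lt (Finset.le_sup (f := id) hi) hN

theorem totalDegree_restrict_le {f : SymFun} {D : ℕ}
    (hD : ∀ α : ℕ →₀ ℕ, D < α.degree → MvPowerSeries.coeff α (f : MvPowerSeries ℕ ℂ) = 0)
    (N : ℕ) : (restrict N f).totalDegree ≤ D := by
  refine Finset.sup_le fun α hα => ?_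
  by_contra! hlt
  rw [MvPolynomial.mem_support_iff, coeff_restrict] at hα
  refine hα (hD _ ?_)
  rw [Finsupp.degree_mapDomain]
  exact hlt

theorem rename_restrict {N : ℕ} (f : SymFun) (σ : Equiv.Perm (Fin N)) :
    MvPolynomial.rename σ (restrict N f) = restrict N f := by
  ext α
  obtain ⟨β, rfl⟩ : ∃ β : Fin N →₀ ℕ, β.mapDomain σ = α :=
    ⟨α.mapDomain σ.symm, by rw [← Finsupp.mapDomain_comp]; simp⟩
  rw [MvPolynomial.coeff_rename_mapDomain _ σ.injective, coeff_restrict, coeff_restrict,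
    ← coeff_mapDomain_perm f (σ.viaFintypeEmbedding Fin.valEmbedding), ← Finsupp.mapDomain_comp,
    ← Finsupp.mapDomain_comp]
  congr 2
  refine congrArg (fun g => Finsupp.mapDomain g β) (funext fun i => ?_)
  exact Equiv.Perm.viaFintypeEmbedding_apply_image σ Fin.valEmbedding i

/-- A monomial of degree at most N involves at most N variables, so a permutation carries it into
the first N. -/
theorem eq_zero_of_restrict_eq_zero {f : SymFun} {N : ℕ}
    (hN : ∀ α : ℕ →₀ ℕ, N < α.degree → MvPowerSeries.coeff α (f : MvPowerSeries ℕ ℂ) = 0)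
    (h : restrict N f = 0) : f = 0 := by
  apply Subtype.ext
  ext α
  by_cases hα : N < α.degree
  · rw [hN α hα]; rfl
  have hcard : α.support.card ≤ N := by
    refine le_trans ?_ (not_lt.mp hα)
    rw [Finsupp.degree_apply, Finset.card_eq_sum_ones]
    exact Finset.sum_le_sum fun i hi => Nat.one_le_iff_ne_zero.mpr (Finsupp.mem_support_iff.mp hi)
  obtain ⟨σ, hσ⟩ := Equiv.Perm.exists_extending_pair
    (fun i : Fin α.support.card => ((α.support.equivFin.symm i : α.support) : ℕ)) Fin.val
    (Subtype.val_injective.comp α.support.equivFin.symm.injective) Fin.val_injective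
  have hsupp : ∀ i ∈ (α.mapDomain σ).support, i < N := by
    intro i hi
    obtain ⟨j, hj, rfl⟩ := Finset.mem_image.mp (Finsupp.mapDomain_support hi)
    have := hσ (α.support.equivFin ⟨j, hj⟩)
    simp only [Equiv.symm_apply_apply] at this
    rw [this]
    exact lt_of_lt_of_le (Fin.is_lt _) hcard
  rw [← coeff_mapDomain_perm f σ, ← coeff_rename_restrict f hsupp, h]
  simp

/-! ### Schur functions -/

/-- The complete homogeneous symmetric function `h_k`. -/
def completeSym (k : ℕ) : SymFun :=
  ⟨fun α => if α.degree = k then 1 else 0, ⟨k, fun _ hα => if_neg hα.ne'⟩, fun e => by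
    ext α
    obtain ⟨β, rfl⟩ : ∃ β, Finsupp.embDomain e.toEmbedding β = α :=
      ⟨α.mapDomain e.symm, by
        rw [Finsupp.embDomain_eq_mapDomain, ← Finsupp.mapDomain_comp]; simp⟩
    have key := MvPowerSeries.coeff_embDomain_rename e.toEmbedding
      (fun α => if α.degree = k then 1 else 0 : MvPowerSeries ℕ ℂ) β
    refine key.trans ?_
    rw [Finsupp.embDomain_eq_mapDomain]
    change (if β.degree = k then (1 : ℂ) else 0) =
      if (Finsupp.mapDomain e β).degree = k then 1 else 0
    rw [Finsupp.degree_mapDomain]⟩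

/-- The complete homogeneous symmetric function `h_k` with `h_k = 0` for negative `k`. -/
def completeSymInt (k : ℤ) : SymFun := if 0 ≤ k then completeSym k.toNat else 0

/-- The Schur function, defined by the Jacobi–Trudi determinant. -/
def schurFun (nu : YoungDiagram) : SymFun :=
  Matrix.det (Matrix.of fun i j : Fin (nu.colLen 0) =>
    completeSymInt ((nu.rowLen i : ℤ) - (i : ℕ) + (j : ℕ)))

/-! ### The Jacobi–Trudi identity in N variables -/

section JacobiTrudi

variable {N : ℕ}

theorem coeff_restrict_completeSym (k : ℕ) (α : Fin N →₀ ℕ) :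
    MvPolynomial.coeff α (restrict N (completeSym k)) = if α.degree = k then 1 else 0 := by
  rw [coeff_restrict]
  change (if (α.mapDomain Fin.val).degree = k then (1 : ℂ) else 0) = _
  rw [Finsupp.degree_mapDomain]

theorem completeSym_zero : completeSym 0 = 1 := by
  apply Subtype.ext
  ext α
  change (if α.degree = 0 then (1 : ℂ) else 0) = MvPowerSeries.coeff α 1
  classical
  rw [MvPowerSeries.coeff_one]
  simp [Finsupp.degree_eq_zero_iff]

/-- The power series `1 - x_i t`. -/
def linFactor (i : Fin N) : PowerSeries (MvPolynomial (Fin N) ℂ) :=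
  1 - PowerSeries.C (MvPolynomial.X i) * PowerSeries.X

theorem geom_mul_linFactor (i : Fin N) :
    PowerSeries.mk (fun n => (MvPolynomial.X i : MvPolynomial (Fin N) ℂ) ^ n) * linFactor i =
      1 := by
  ext1 n
  rw [linFactor, mul_sub, mul_one, ← mul_assoc, map_sub, mul_comm _ (PowerSeries.C _)]
  rcases n with _ | n
  · simp
  · rw [PowerSeries.coeff_succ_mul_X, PowerSeries.coeff_C_mul, PowerSeries.coeff_mk,
      PowerSeries.coeff_mk, PowerSeries.coeff_one, if_neg (Nat.succ_ne_zero n), pow_succ']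
    ring

theorem mk_completeSym_eq_prod :
    PowerSeries.mk (fun k => restrict N (completeSym k)) =
      ∏ i, PowerSeries.mk (fun n => (MvPolynomial.X i : MvPolynomial (Fin N) ℂ) ^ n) := by
  classical
  ext1 k
  rw [PowerSeries.coeff_mk, PowerSeries.coeff_prod]
  have h : ∀ l : Fin N →₀ ℕ, ∏ i, PowerSeries.coeff (l i)
      (PowerSeries.mk (fun n => (MvPolynomial.X i : MvPolynomial (Fin N) ℂ) ^ n)) =
      MvPolynomial.monomial l 1 := by
    intro l
    rw [MvPolynomial.monomial_eq]
    simp [Finsupp.prod_fintype]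
  rw [Finset.sum_congr rfl fun l _ => h l]
  ext α
  rw [coeff_restrict_completeSym, MvPolynomial.coeff_sum]
  simp only [MvPolynomial.coeff_monomial]
  rw [Finset.sum_ite_eq']
  simp [Finset.mem_finsuppAntidiag, Finsupp.degree_eq_sum]

theorem coeff_prod_linFactor (s : Finset (Fin N)) {k : ℕ} (hk : s.card < k) :
    PowerSeries.coeff k (∏ i ∈ s, linFactor i) = 0 := by
  classical
  induction s using Finset.induction_on generalizing k with
  | empty => rw [Finset.prod_empty, PowerSeries.coeff_one, if_neg (by simp at hk; omega)]
  | insert i s hi ih =>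
    rw [Finset.card_insert_of_notMem hi] at hk
    obtain ⟨k, rfl⟩ : ∃ k', k = k' + 1 := ⟨k - 1, by omega⟩
    rw [Finset.prod_insert hi, linFactor, sub_mul, one_mul, map_sub, ih (by omega),
      mul_assoc, PowerSeries.coeff_C_mul, mul_comm PowerSeries.X, PowerSeries.coeff_succ_mul_X,
      ih (by omega)]
    ring

/-- The coefficients with `x_j^n = ∑_k h_{n-k} c_{k,j}`. -/
def powCoeff (k : ℕ) (j : Fin N) : MvPolynomial (Fin N) ℂ :=
  PowerSeries.coeff k (∏ i ∈ Finset.univ.erase j, linFactor i)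

/-- Multiplying ∏ 1/(1 - x_i t) by the factors 1 - x_i t with i ≠ j leaves the geometric series of
x_j. Those N - 1 factors have degree below N in t, so indices k < N suffice. -/
theorem X_pow_eq_sum (n : ℕ) (j : Fin N) :
    (MvPolynomial.X j : MvPolynomial (Fin N) ℂ) ^ n =
      ∑ k ∈ Finset.range N, restrict N (completeSymInt ((n : ℤ) - k)) * powCoeff k j := by
  have hgen : PowerSeries.mk (fun k => restrict N (completeSym k)) *
      ∏ i ∈ Finset.univ.erase j, linFactor i =
      PowerSeries.mk (fun n => (MvPolynomial.X j : MvPolynomial (Fin N) ℂ) ^ n) := by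
    rw [mk_completeSym_eq_prod, ← Finset.mul_prod_erase _ _ (Finset.mem_univ j), mul_assoc,
      ← Finset.prod_mul_distrib, Finset.prod_congr rfl fun i _ => geom_mul_linFactor i,
      Finset.prod_const_one, mul_one]
  have h := congrArg (PowerSeries.coeff n) hgen
  rw [PowerSeries.coeff_mk, mul_comm, PowerSeries.coeff_mul,
    Finset.Nat.sum_antidiagonal_eq_sum_range_succ_mk] at h
  rw [← h]
  have h1 : ∀ k ∈ Finset.range (n + 1),
      PowerSeries.coeff k (∏ i ∈ Finset.univ.erase j, linFactor i) *
        PowerSeries.coeff (n - k) (PowerSeries.mk (fun k => restrict N (completeSym k))) =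
      restrict N (completeSymInt ((n : ℤ) - k)) * powCoeff k j := by
    intro k hk
    have hk' := Finset.mem_range.mp hk
    rw [PowerSeries.coeff_mk, mul_comm, powCoeff, completeSymInt, if_pos (by omega)]
    congr 4
    omega
  rw [Finset.sum_congr rfl h1]
  have h2 : Finset.range (n + 1) ⊆ Finset.range (n + 1 + N) := Finset.range_mono (by omega)
  have h3 : Finset.range N ⊆ Finset.range (n + 1 + N) := Finset.range_mono (by omega)
  rw [Finset.sum_subset h2, ← Finset.sum_subset h3]
  · intro k _ hk
    rw [powCoeff, coeff_prod_linFactor, mul_zero]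
    rw [Finset.card_erase_of_mem (Finset.mem_univ j), Finset.card_univ, Fintype.card_fin]
    have := j.2
    simp only [Finset.mem_range] at hk
    omega
  · intro k _ hk
    simp only [Finset.mem_range] at hk
    rw [completeSymInt, if_neg (by omega), map_zero, zero_mul]

/-- The expansion of x_j^n factors the alternant matrix through the complete functions, with a
second factor independent of ν. Taking ν = ∅ later identifies the determinant of that factor as the
Vandermonde product. -/
theorem monomialAlternant_eq_mul {nu : YoungDiagram} (hnu : nu.colLen 0 ≤ N) :
    monomialAlternant N nu = restrict N (schurFun nu) *
      Matrix.det (Matrix.of fun k j : Fin N => powCoeff (N - 1 - (k : ℕ)) j) := by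
  have h1 : restrict N (schurFun nu) = Matrix.det (Matrix.of fun i k : Fin N =>
      restrict N (completeSymInt ((nu.rowLen i : ℤ) - (i : ℕ) + (k : ℕ)))) := by
    rw [schurFun, ← det_reduce (fun i k : ℕ => completeSymInt ((nu.rowLen i : ℤ) - i + k)) hnu,
      ← AlgHom.coe_toRingHom, RingHom.map_det]
    · rfl
    · intro i k hi hk
      rw [completeSymInt, rowLen_eq_zero.mpr hi, if_neg]
      omega
    · intro i hi
      rw [rowLen_eq_zero.mpr hi]
      simp [completeSymInt, completeSym_zero]
  rw [h1, ← Matrix.det_mul, monomialAlternant, polyDet]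
  refine congrArg Matrix.det (Matrix.ext fun i j => ?_)
  rw [Matrix.mul_apply, Matrix.of_apply, map_pow, Polynomial.aeval_X, X_pow_eq_sum,
    ← Finset.sum_range_reflect, Finset.sum_range]
  refine Finset.sum_congr rfl fun k _ => ?_
  simp only [Matrix.of_apply, shiftedRow]
  congr 3
  have := i.2
  have := k.2
  omega

theorem restrict_schurFun_mul_vandermonde {nu : YoungDiagram} (hnu : nu.colLen 0 ≤ N) :
    restrict N (schurFun nu) * vandermonde N = monomialAlternant N nu := by
  have h := monomialAlternant_eq_mul (N := N) (nu := ⊥) (by rw [colLen_bot]; exact Nat.zero_le N)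
  have h2 : schurFun ⊥ = 1 := by
    have : IsEmpty (Fin ((⊥ : YoungDiagram).colLen 0)) := by rw [colLen_bot]; infer_instance
    exact Matrix.det_isEmpty
  rw [h2, map_one, one_mul, ← vandermonde_eq_monomialAlternant] at h
  rw [h, monomialAlternant_eq_mul hnu]

end JacobiTrudi

/-! ### Schur functions form a basis -/

theorem schurFun_linearIndependent : LinearIndependent ℂ schurFun := by
  rw [linearIndependent_iff']
  intro s g hg l hl
  set N := s.sup fun nu => nu.colLen 0
  have hN : ∀ nu ∈ s, nu.colLen 0 ≤ N := fun nu hnu =>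
    Finset.le_sup (f := fun nu : YoungDiagram => nu.colLen 0) hnu
  have h := congrArg (fun f => MvPolynomial.coeff (Finsupp.equivFunOnFinite.symm (shiftedRow N l))
    (restrict N f * vandermonde N)) hg
  simp only [map_sum, map_smul, Finset.sum_mul, smul_mul_assoc, map_zero, zero_mul,
    MvPolynomial.coeff_sum, MvPolynomial.coeff_smul, MvPolynomial.coeff_zero] at h
  rw [Finset.sum_eq_single l] at h
  · rw [restrict_schurFun_mul_vandermonde (hN l hl),
      coeff_monomialAlternant _ (by simpa using shiftedRow_strictAnti N l), if_pos (by simp)] at h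
    simpa using h
  · intro nu hnu hne
    rw [restrict_schurFun_mul_vandermonde (hN nu hnu),
      coeff_monomialAlternant _ (by simpa using shiftedRow_strictAnti N l), if_neg, smul_zero]
    intro heq
    exact hne (shiftedRow_injective (hN nu hnu) (hN l hl) (by simpa using heq))
  · exact fun h => absurd hl h

theorem degree_eq_of_coeff_monomialAlternant_ne_zero {N : ℕ} {nu : YoungDiagram} {α : Fin N →₀ ℕ}
    (h : MvPolynomial.coeff α (monomialAlternant N nu) ≠ 0) :
    α.degree = ∑ i, shiftedRow N nu i := by
  rw [monomialAlternant, coeff_polyDet, Matrix.det_apply] at h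
  obtain ⟨σ, -, hσ⟩ := Finset.exists_ne_zero_of_sum_ne_zero h
  have h2 : ∀ j, α j = shiftedRow N nu (σ j) := by
    intro j
    have := Finset.prod_ne_zero_iff.mp (right_ne_zero_of_smul hσ) j (Finset.mem_univ j)
    simpa [Polynomial.coeff_X_pow] using this
  rw [Finsupp.degree_eq_sum, Finset.sum_congr rfl fun j _ => h2 j]
  exact Equiv.sum_comp σ (shiftedRow N nu)

/-- The restriction of f times V is alternating, hence a combination of alternants s_ν V, and
degrees force |ν| ≤ D. Dividing by V gives an identity in N variables. -/
theorem span_schurFun : ⊤ ≤ Submodule.span ℂ (Set.range schurFun) := by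
  intro f _
  obtain ⟨D, hD⟩ := f.2.1
  set S := (finite_card_le D).toFinset
  have hbound : ∀ nu : YoungDiagram, ∃ E : ℕ, ∀ α : ℕ →₀ ℕ, E < α.degree →
      MvPowerSeries.coeff α (schurFun nu : MvPowerSeries ℕ ℂ) = 0 := fun nu => (schurFun nu).2.1
  choose E hE using hbound
  -- Large enough that neither f nor any Schur function involved has terms of degree above N, so
  -- that an identity in N variables lifts to symmetric functions.
  set N := max D (S.sup E)
  have hcol : ∀ nu ∈ S, nu.colLen 0 ≤ N := by
    intro nu hnu
    have : nu.card ≤ D := by simpa [S] using hnu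
    exact (colLen_le_card nu).trans (this.trans (le_max_left _ _))
  have h := eq_sum_monomialAlternant (g := restrict N f * vandermonde N) (fun σ => by
      rw [map_mul, rename_restrict, vandermonde_eq_monomialAlternant, monomialAlternant,
        rename_polyDet]
      ring) S hcol (by
      intro nu hnu hnot
      by_contra hne
      refine hnot ?_
      have h1 := MvPolynomial.le_totalDegree (MvPolynomial.mem_support_iff.mpr hne)
      have h2 := h1.trans (MvPolynomial.totalDegree_mul _ _)
      have h3 := totalDegree_restrict_le hD N
      have h4 : (vandermonde N).totalDegree ≤ ∑ i : Fin N, (N - 1 - (i : ℕ)) := by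
        refine Finset.sup_le fun α hα => ?_
        rw [vandermonde_eq_monomialAlternant, MvPolynomial.mem_support_iff] at hα
        refine (degree_eq_of_coeff_monomialAlternant_ne_zero hα).le.trans ?_
        simp [shiftedRow, rowLen_bot]
      have h5 : (Finsupp.equivFunOnFinite.symm (shiftedRow N nu)).sum (fun _ e => e) =
          ∑ i, shiftedRow N nu i := by
        rw [Finsupp.sum_fintype _ _ fun _ => rfl]
        simp
      rw [h5, sum_shiftedRow nu hnu] at h2
      have h6 : nu.card ≤ D := by omega
      simpa [S] using h6)
  set a := fun nu : YoungDiagram => MvPolynomial.coeff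
    (Finsupp.equivFunOnFinite.symm (shiftedRow N nu)) (restrict N f * vandermonde N)
  have h0 : restrict N (f - ∑ nu ∈ S, a nu • schurFun nu) = 0 := by
    refine mul_right_cancel₀ (vandermonde_ne_zero N) ?_
    rw [zero_mul, map_sub, sub_mul, h, map_sum, Finset.sum_mul, sub_eq_zero]
    refine Finset.sum_congr rfl fun nu hnu => ?_
    rw [map_smul, smul_mul_assoc, restrict_schurFun_mul_vandermonde (hcol nu hnu)]
  have hf := eq_zero_of_restrict_eq_zero (N := N) (fun α hα => by
    have hz : MvPowerSeries.coeff α (f : MvPowerSeries ℕ ℂ) = 0 :=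
      hD α (lt_of_le_of_lt (le_max_left _ _) hα)
    have hs : ∀ nu ∈ S, MvPowerSeries.coeff α (schurFun nu : MvPowerSeries ℕ ℂ) = 0 :=
      fun nu hnu => hE nu α (lt_of_le_of_lt ((Finset.le_sup hnu).trans (le_max_right _ _)) hα)
    push_cast
    rw [map_sub, hz, map_sum, zero_sub, neg_eq_zero]
    refine Finset.sum_eq_zero fun nu hnu => ?_
    rw [MvPowerSeries.coeff_smul, hs nu hnu, mul_zero]) h0
  rw [sub_eq_zero] at hf
  rw [hf]
  exact Submodule.sum_mem _ fun nu _ =>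
    Submodule.smul_mem _ _ (Submodule.subset_span ⟨nu, rfl⟩)

/-- The basis of Schur functions. -/
def schurBasis : Module.Basis YoungDiagram ℂ SymFun :=
  Module.Basis.mk schurFun_linearIndependent span_schurFun

theorem schurBasis_apply (nu : YoungDiagram) : schurBasis nu = schurFun nu :=
  Module.Basis.mk_apply _ _ _

/-! ### The interpolation symmetric functions in the Schur basis -/

theorem det_div_mul {N : ℕ} (f g : Fin N → ℂ) (e : Fin N → Fin N → ℂ) :
    Matrix.det (Matrix.of fun i j => f i / g j * e i j) =
      (∏ i, f i) / (∏ j, g j) * Matrix.det (Matrix.of e) := by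
  have h1 := Matrix.det_mul_column f (Matrix.of fun i j => (g j)⁻¹ * e i j)
  have h2 := Matrix.det_mul_row (fun j => (g j)⁻¹) (Matrix.of e)
  rw [Finset.prod_inv_distrib] at h2
  simp only [Matrix.of_apply] at h1 h2
  rw [div_eq_mul_inv, mul_assoc, ← h2, ← h1]
  congr 1
  ext i j
  simp only [Matrix.of_apply]
  ring

/-- The leading node `q^{N-1}`. -/
def leadNode (q : ℂ) (N : ℕ) : ℂ := q ^ ((N : ℤ) - 1)

theorem leadNode_mul {q : ℂ} (hq : q ≠ 0) (N k : ℕ) :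
    leadNode q N * q⁻¹ ^ k = q ^ ((N : ℤ) - k - 1) := by
  rw [leadNode, inv_pow, ← zpow_natCast, ← zpow_neg, ← zpow_add₀ hq]
  congr 1
  ring

/-- The entries of the determinant expressing interpolation functions in Schur functions. -/
def interpEntry (q : ℂ) (mu nu : YoungDiagram) (i j : ℕ) : ℂ :=
  let r : ℤ := (mu.rowLen i : ℤ) - i - nu.rowLen j + j
  if 0 ≤ r then
    (-1) ^ r.toNat * q ^ r.toNat.choose 2 * (q ^ ((i : ℤ) + 1 - mu.rowLen i)) ^ r.toNat /
      qPoch q q r.toNat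
  else 0

/-- The coefficients of interpolation functions in Schur functions. -/
def interpCoeff (q : ℂ) (mu nu : YoungDiagram) : ℂ :=
  Matrix.det (Matrix.of fun i j : Fin (mu.colLen 0) => interpEntry q mu nu i j)

/-- The interpolation symmetric function as a combination of Schur functions. -/
def interpSchur (q : ℂ) (mu : YoungDiagram) : SymFun :=
  ∑ nu ∈ subdiagrams mu, interpCoeff q mu nu • schurFun nu

/-- The linear operator dividing the Schur function of `nu` by `rowRatio q N nu`. -/
def schurScale (q : ℂ) (N : ℕ) : SymFun →ₗ[ℂ] SymFun :=
  schurBasis.constr ℂ fun nu => (rowRatio q N nu)⁻¹ • schurFun nu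

theorem schurScale_schurFun (q : ℂ) (N : ℕ) (nu : YoungDiagram) :
    schurScale q N (schurFun nu) = (rowRatio q N nu)⁻¹ • schurFun nu := by
  rw [← schurBasis_apply, schurScale, Module.Basis.constr_basis, schurBasis_apply]

theorem shiftedRow_cast {N : ℕ} (mu : YoungDiagram) (i : Fin N) :
    (shiftedRow N mu i : ℤ) = mu.rowLen i + N - 1 - (i : ℕ) := by
  have := i.2
  rw [shiftedRow]
  omega

section generic

variable {q : ℂ} (hw : ∀ n, qPoch q q n ≠ 0) (hq : q ≠ 0)
include hw

theorem prod_div_prod_eq_rowRatio (N : ℕ) (mu nu : YoungDiagram) :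
    (∏ i, qPoch q q (shiftedRow N mu i)) / (∏ i, qPoch q q (shiftedRow N nu i)) =
      rowRatio q N mu / rowRatio q N nu := by
  have h : ∏ i : Fin N, qPoch q q (N - 1 - (i : ℕ)) ≠ 0 :=
    Finset.prod_ne_zero_iff.mpr fun _ _ => hw _
  have h' : ∏ i, qPoch q q (shiftedRow N nu i) ≠ 0 :=
    Finset.prod_ne_zero_iff.mpr fun _ _ => hw _
  rw [rowRatio, rowRatio, Finset.prod_div_distrib, Finset.prod_div_distrib]
  field_simp

include hq

/-- The leading node q^{N-1} cancels the N in q^{-(μ_i+N-i-2)}. The remaining N-dependence sits in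
q-factorials depending on the row or on the column alone, which leave the determinant. -/
theorem coeff_newtonUni_shiftedRow {N : ℕ} (mu nu : YoungDiagram) (i j : Fin N) :
    (newtonUni q (leadNode q N) (shiftedRow N mu i)).coeff (shiftedRow N nu j) =
      qPoch q q (shiftedRow N mu i) / qPoch q q (shiftedRow N nu j) * interpEntry q mu nu i j := by
  have hi := shiftedRow_cast mu i
  have hj := shiftedRow_cast nu j
  rw [interpEntry]
  rcases le_or_gt (shiftedRow N nu j) (shiftedRow N mu i) with h | h
  · have hr : (mu.rowLen i : ℤ) - (i : ℕ) - nu.rowLen j + (j : ℕ) =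
        ((shiftedRow N mu i - shiftedRow N nu j : ℕ) : ℤ) := by omega
    simp only [hr]
    rw [if_pos (by omega), Int.toNat_natCast, coeff_newtonUni hw hq _ h, gaussBinom,
      if_pos (Nat.sub_le _ _), Nat.sub_sub_self h]
    have hpow : (leadNode q N * q⁻¹ ^ (shiftedRow N mu i - 1)) ^
        (shiftedRow N mu i - shiftedRow N nu j) =
        (q ^ (((i : ℕ) : ℤ) + 1 - mu.rowLen i)) ^ (shiftedRow N mu i - shiftedRow N nu j) := by
      -- When the exponent is 0 the subtraction of 1 is truncated, but then the outer power is 0 as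
      -- well.
      rcases Nat.eq_zero_or_pos (shiftedRow N mu i) with h0 | h0
      · simp [h0]
      · rw [leadNode_mul hq]
        congr 2
        omega
    rw [hpow]
    have h1 := hw (shiftedRow N mu i - shiftedRow N nu j)
    have h2 := hw (shiftedRow N nu j)
    field_simp
  · rw [if_neg (by omega), mul_zero]
    exact Polynomial.coeff_eq_zero_of_natDegree_lt (by rwa [newtonUni_natDegree])

theorem det_coeff_newtonUni {N : ℕ} {mu nu : YoungDiagram} (hmu : mu.colLen 0 ≤ N)
    (hnu : nu ≤ mu) :
    Matrix.det (Matrix.of fun i j =>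
      (newtonUni q (leadNode q N) (shiftedRow N mu i)).coeff (shiftedRow N nu j)) =
      rowRatio q N mu / rowRatio q N nu * interpCoeff q mu nu := by
  simp only [coeff_newtonUni_shiftedRow hw hq]
  rw [det_div_mul (fun i => qPoch q q (shiftedRow N mu i)) (fun i => qPoch q q (shiftedRow N nu i))
    (fun i j => interpEntry q mu nu i j), prod_div_prod_eq_rowRatio hw, interpCoeff,
    det_reduce (interpEntry q mu nu) hmu]
  · intro i j hi hj
    rw [interpEntry, rowLen_eq_zero.mpr hi]
    exact if_neg (by omega)
  · intro i hi
    rw [interpEntry, rowLen_eq_zero.mpr hi, rowLen_eq_zero.mpr ((colLen_mono hnu).trans hi)]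
    simp [qPoch_zero]

/-- An exact relation at finite N: each Schur coefficient depends on N only through r_N(μ)/r_N(ν).
The numerator comes out as a scalar and the denominator is absorbed by `schurScale`. -/
theorem det_newtonUni_eq {N : ℕ} {mu : YoungDiagram} (hmu : mu.colLen 0 ≤ N) :
    Matrix.det (Matrix.of fun i j : Fin N => Polynomial.aeval (MvPolynomial.X j)
      (newtonUni q (leadNode q N) (shiftedRow N mu i))) =
      rowRatio q N mu • (restrict N (schurScale q N (interpSchur q mu)) * vandermonde N) := by
  have h := det_eq_sum_det hmu (newtonUni q (leadNode q N))
    (fun n => (newtonUni_natDegree q _ n).le)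
    (fun j => (Polynomial.aeval (MvPolynomial.X j : MvPolynomial (Fin N) ℂ)).toLinearMap)
  simp only [AlgHom.toLinearMap_apply] at h
  rw [h, interpSchur, map_sum, map_sum, Finset.sum_mul, Finset.smul_sum]
  refine Finset.sum_congr rfl fun nu hnu => ?_
  have hnu' := mem_subdiagrams.mp hnu
  rw [det_coeff_newtonUni hw hq hmu hnu', map_smul, map_smul, schurScale_schurFun, map_smul,
    smul_mul_assoc, smul_mul_assoc,
    restrict_schurFun_mul_vandermonde ((colLen_mono hnu').trans hmu), smul_smul, smul_smul]
  rw [monomialAlternant, polyDet]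
  congr 1
  ring

end generic

theorem interpPoly_eq {q : ℝ} (hw : ∀ n, qPoch q q n ≠ 0) (hq : (q : ℂ) ≠ 0) {N : ℕ}
    {mu : YoungDiagram} (hmu : mu.colLen 0 ≤ N) :
    interpPoly q mu N = rowRatio q N mu • restrict N (schurScale q N (interpSchur q mu)) := by
  rw [interpPoly, multiSchur, if_pos hmu]
  refine mul_left_cancel₀ (vandermonde_ne_zero N) ?_
  rw [← (vandermonde_dvd_alternant _ N mu).choose_spec, mul_smul_comm, mul_comm (vandermonde N),
    ← det_newtonUni_eq hw hq hmu, alternant]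
  refine congrArg Matrix.det (Matrix.ext fun i j => ?_)
  simp only [Matrix.of_apply, newton, newtonUni, map_prod, map_sub, Polynomial.aeval_X,
    Polynomial.aeval_C, leadNode_mul hq, MvPolynomial.algebraMap_eq]
  rfl

theorem convergesTo_interpPoly {q : ℝ} (hw : ∀ n, qPoch q q n ≠ 0) (hq : (q : ℂ) ≠ 0)
    (hq1 : ‖(q : ℂ)‖ < 1) (mu : YoungDiagram) :
    ConvergesTo (interpPoly q mu) (interpSchur q mu) := by
  have hexp : ∀ N, mu.colLen 0 ≤ N → interpPoly q mu N = ∑ nu ∈ subdiagrams mu,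
      (rowRatio q N mu * (rowRatio q N nu)⁻¹ * interpCoeff q mu nu) •
        restrict N (schurFun nu) := by
    intro N hN
    rw [interpPoly_eq hw hq hN, interpSchur, map_sum, map_sum, Finset.smul_sum]
    refine Finset.sum_congr rfl fun nu _ => ?_
    rw [map_smul, map_smul, schurScale_schurFun, map_smul, smul_smul, smul_smul]
    congr 1
    ring
  constructor
  · choose E hE using fun nu : YoungDiagram => (schurFun nu).2.1
    refine ⟨(subdiagrams mu).sup E, fun N => ?_⟩
    by_cases hN : mu.colLen 0 ≤ N
    · rw [hexp N hN]
      refine (MvPolynomial.totalDegree_finsetSum _ _).trans (Finset.sup_mono_fun fun nu _ => ?_)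
      exact (MvPolynomial.totalDegree_smul_le _ _).trans (totalDegree_restrict_le (hE nu) N)
    · rw [interpPoly, multiSchur, if_neg hN, MvPolynomial.totalDegree_zero]
      exact Nat.zero_le _
  · intro α
    have hlim : Tendsto (fun N => ∑ nu ∈ subdiagrams mu,
        (rowRatio q N mu * (rowRatio q N nu)⁻¹ * interpCoeff q mu nu) *
          MvPolynomial.coeff α (MvPolynomial.rename Fin.val (restrict N (schurFun nu)))) atTop
        (𝓝 (∑ nu ∈ subdiagrams mu, (1 * 1⁻¹ * interpCoeff q mu nu) *
          MvPowerSeries.coeff α (schurFun nu : MvPowerSeries ℕ ℂ))) :=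
      tendsto_finsetSum _ fun nu _ => (((tendsto_rowRatio hw hq1 mu).mul
        ((tendsto_rowRatio hw hq1 nu).inv₀ one_ne_zero)).mul_const _).mul
        (tendsto_coeff_rename_restrict _ _)
    have hval : ∑ nu ∈ subdiagrams mu, (1 * 1⁻¹ * interpCoeff q mu nu) *
        MvPowerSeries.coeff α (schurFun nu : MvPowerSeries ℕ ℂ) =
        MvPowerSeries.coeff α (interpSchur q mu : MvPowerSeries ℕ ℂ) := by
      rw [interpSchur]
      push_cast
      rw [map_sum]
      refine Finset.sum_congr rfl fun nu _ => ?_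
      rw [MvPowerSeries.coeff_smul]
      ring
    rw [← hval]
    refine hlim.congr' ?_
    filter_upwards [eventually_ge_atTop (mu.colLen 0)] with N hN
    rw [hexp N hN, map_sum, MvPolynomial.coeff_sum]
    refine Finset.sum_congr rfl fun nu _ => ?_
    rw [map_smul, MvPolynomial.coeff_smul, smul_eq_mul]

theorem ConvergesTo.unique {F : (N : ℕ) → MvPolynomial (Fin N) ℂ} {G G' : SymFun}
    (h : ConvergesTo F G) (h' : ConvergesTo F G') : G = G' := by
  apply Subtype.ext
  ext α
  exact tendsto_nhds_unique (h.2 α) (h'.2 α)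

theorem interpFun_spec {q : ℝ} (hw : ∀ n, qPoch q q n ≠ 0) (hq : (q : ℂ) ≠ 0)
    (hq1 : ‖(q : ℂ)‖ < 1) (mu : YoungDiagram) :
    ConvergesTo (interpPoly q mu) (interpFun q mu) ∧ interpFun q mu = interpSchur q mu := by
  have h : ∃ G : SymFun, ConvergesTo (interpPoly q mu) G :=
    ⟨_, convergesTo_interpPoly hw hq hq1 mu⟩
  have h1 : ConvergesTo (interpPoly q mu) (interpFun q mu) := by
    rw [interpFun, dif_pos h]
    exact h.choose_spec
  exact ⟨h1, h1.unique (convergesTo_interpPoly hw hq hq1 mu)⟩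

/-! ### Triangular changes of basis -/

section triangular

variable {V : Type*} [AddCommGroup V] [Module ℂ V]

/-- Independence: in a vanishing combination, a maximal diagram with nonzero coefficient can be
isolated. Spanning: induction on the number of cells, solving for the diagonal term. -/
theorem exists_basis_of_triangular (b : Module.Basis YoungDiagram ℂ V)
    (t : YoungDiagram → YoungDiagram → ℂ) (ht : ∀ l, t l l ≠ 0) :
    ∃ b' : Module.Basis YoungDiagram ℂ V,
      ∀ l, b' l = ∑ m ∈ subdiagrams l, t l m • b m := by
  classical
  set v : YoungDiagram → V := fun l => ∑ m ∈ subdiagrams l, t l m • b m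
  have hrepr : ∀ l m, b.repr (v l) m = if m ≤ l then t l m else 0 := by
    intro l m
    simp only [v, map_sum, map_smul, Module.Basis.repr_self, Finsupp.coe_finsetSum,
      Finset.sum_apply, Finsupp.smul_apply, Finsupp.single_apply, smul_eq_mul, mul_ite, mul_one,
      mul_zero]
    rw [Finset.sum_ite_eq']
    simp only [mem_subdiagrams]
  have hli : LinearIndependent ℂ v := by
    rw [linearIndependent_iff']
    intro s g hg
    by_contra! hcon
    obtain ⟨l0, hl0, hgl0⟩ := hcon
    obtain ⟨l, hl⟩ := (s.filter fun l => g l ≠ 0).exists_maximal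
      ⟨l0, Finset.mem_filter.mpr ⟨hl0, hgl0⟩⟩
    obtain ⟨hls, hgl⟩ := Finset.mem_filter.mp hl.prop
    have h := congrArg (fun x => b.repr x l) hg
    simp only [map_sum, map_smul, Finsupp.coe_finsetSum, Finset.sum_apply, Finsupp.smul_apply,
      hrepr, smul_eq_mul, map_zero, Finsupp.zero_apply] at h
    rw [Finset.sum_eq_single l, if_pos le_rfl] at h
    · exact (mul_ne_zero hgl (ht l)) h
    · intro m hm hne
      by_cases hgm : g m = 0
      · rw [hgm, zero_mul]
      · rw [if_neg, mul_zero]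
        intro hle
        exact hne (le_antisymm (hl.le_of_ge (Finset.mem_filter.mpr ⟨hm, hgm⟩) hle) hle)
    · exact fun h => absurd hls h
  have hb : ∀ k, ∀ l : YoungDiagram, l.card ≤ k → b l ∈ Submodule.span ℂ (Set.range v) := by
    intro k
    induction k using Nat.strong_induction_on with
    | _ k ih =>
      intro l hl
      have hsplit : t l l • b l = v l - ∑ m ∈ (subdiagrams l).erase l, t l m • b m := by
        simp only [v]
        rw [← Finset.add_sum_erase _ _ (mem_subdiagrams.mpr (le_refl l)), add_sub_cancel_right]
      rw [← Submodule.smul_mem_iff _ (ht l), hsplit]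
      refine Submodule.sub_mem _ (Submodule.subset_span ⟨l, rfl⟩)
        (Submodule.sum_mem _ fun m hm => Submodule.smul_mem _ _ ?_)
      obtain ⟨hne, hm⟩ := Finset.mem_erase.mp hm
      have hlt : m < l := lt_of_le_of_ne (mem_subdiagrams.mp hm) hne
      have hcard : m.card < l.card := Finset.card_lt_card (YoungDiagram.cells_ssubset_iff.mpr hlt)
      exact ih m.card (by omega) m le_rfl
  have hspan : ⊤ ≤ Submodule.span ℂ (Set.range v) := by
    rw [← b.span_eq, Submodule.span_le]
    rintro _ ⟨l, rfl⟩
    exact hb l.card l le_rfl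
  exact ⟨Module.Basis.mk hli hspan, fun l => Module.Basis.mk_apply _ _ _⟩

end triangular

theorem interpCoeff_self (q : ℂ) (mu : YoungDiagram) : interpCoeff q mu mu = 1 := by
  rw [interpCoeff, Matrix.det_of_isUpperTriangular]
  · refine Finset.prod_eq_one fun i _ => ?_
    simp [interpEntry, qPoch_zero]
  · intro i j hij
    have h1 := mu.rowLen_anti j i (le_of_lt hij)
    have h2 : (j : ℕ) < i := hij
    rw [Matrix.of_apply, interpEntry]
    exact if_neg (by omega)

/-- The `q`-Meixner function before the dilation of the variables. -/
def meixnerCore (q a : ℝ) (c d : ℂ) (l : YoungDiagram) : SymFun :=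
  ∑ m ∈ subdiagrams l, sigmaCoeff q a c d l m • interpSchur q m

theorem sigmaCoeff_self_ne_zero (q a : ℝ) {c : ℂ} (hc : c ≠ 0) (d : ℂ) (l : YoungDiagram) :
    sigmaCoeff q a c d l l ≠ 0 := by
  rw [sigmaCoeff, Matrix.det_of_isUpperTriangular]
  · rw [Finset.prod_eq_one fun i _ => by simp [sigmaEntry, qPoch_zero]]
    simp [hc]
  · intro i j hij
    have h1 := l.rowLen_anti j i (le_of_lt hij)
    have h2 : (j : ℕ) < i := hij
    rw [Matrix.of_apply, sigmaEntry]
    exact if_neg (by omega)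

/-- Two triangular changes of basis: from Schur to interpolation functions, then to q-Meixner
functions. -/
theorem exists_basis_meixnerCore (q a : ℝ) {c : ℂ} (hc : c ≠ 0) (d : ℂ) :
    ∃ b : Module.Basis YoungDiagram ℂ SymFun, ∀ l, b l = meixnerCore q a c d l := by
  obtain ⟨b, hb⟩ := exists_basis_of_triangular schurBasis (interpCoeff q)
    fun l => by rw [interpCoeff_self]; exact one_ne_zero
  obtain ⟨b', hb'⟩ := exists_basis_of_triangular b (sigmaCoeff q a c d)
    fun l => sigmaCoeff_self_ne_zero q a hc d l
  refine ⟨b', fun l => (hb' l).trans (Finset.sum_congr rfl fun m _ => ?_)⟩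
  rw [hb, interpSchur]
  simp only [schurBasis_apply]

/-! ### The polynomial ensemble in `N` variables -/

/-- The factor `A` of the moments in `N` variables. -/
def momentScale (q a d : ℂ) (N : ℕ) : ℂ := -(a / d * q ^ (2 * (N : ℤ) - 3))

/-- The parameters of the `q`-Pochhammer symbols in the moments in `N` variables. -/
def momentParam (q a c : ℂ) (N : ℕ) : ℂ := c * q / a * q ^ (1 - (N : ℤ))

section ensemble

variable {q a c d : ℂ} (hw : ∀ n, qPoch q q n ≠ 0) (hq : q ≠ 0) (ha : a ≠ 0) (hc : c ≠ 0)
  (hd : d ≠ 0)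

include hq ha in
-- Supplies both hypotheses of `uniMoment_mul`. The parameter d yields the nodes starting at
-- q^{N-1}, those of the interpolation polynomials; the parameter c yields the companion nodes
-- starting at (c/d)q^{N-1}.
theorem momentScale_mul_param (c : ℂ) (N : ℕ) :
    momentScale q a d N * momentParam q a c N = -(c / d * leadNode q N) := by
  have h : q ^ (2 * (N : ℤ) - 3) * q * q ^ (1 - (N : ℤ)) = q ^ ((N : ℤ) - 1) := by
    rw [← zpow_add_one₀ hq, ← zpow_add₀ hq]
    congr 1
    ring
  rw [momentScale, momentParam, leadNode, ← h]
  field_simp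

/-- The part of the Newton coefficients that depends on one index. -/
def rowFactor (q a d : ℂ) (N n : ℕ) : ℂ :=
  (-momentScale q a d N) ^ n / (q ^ n.choose 2) ^ 2 * qPoch q q n

include hq ha hd in
theorem neg_momentScale_ne_zero (N : ℕ) : -momentScale q a d N ≠ 0 := by
  rw [momentScale, neg_neg]
  exact mul_ne_zero (div_ne_zero ha hd) (zpow_ne_zero _ hq)

include hq ha hd hw in
theorem rowFactor_ne_zero (N n : ℕ) : rowFactor q a d N n ≠ 0 :=
  mul_ne_zero (div_ne_zero (pow_ne_zero _ (neg_momentScale_ne_zero hq ha hd N))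
    (pow_ne_zero _ (pow_ne_zero _ hq))) (hw n)

include hq hw in
-- The exponent 2N - 3 in `momentScale` is matched to the term 2(N-1)|λ| coming from the binomials:
-- their difference is -|λ|, which turns a/d into a/(qd) and removes N.
theorem prod_rowFactor (a d : ℂ) {N : ℕ} {l : YoungDiagram} (hl : l.colLen 0 ≤ N) :
    ∏ i, rowFactor q a d N (shiftedRow N l i) =
      (a / (q * d)) ^ l.card * q ^ (-2 * (nStat l.transpose - nStat l)) * rowRatio q N l *
        ∏ i : Fin N, rowFactor q a d N (N - 1 - (i : ℕ)) := by
  have hprod : ∀ n : Fin N → ℕ, ∏ i, rowFactor q a d N (n i) =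
      (a / d) ^ (∑ i, n i) * q ^ ((2 * (N : ℤ) - 3) * (∑ i, (n i : ℤ)) -
        2 * ∑ i, ((n i).choose 2 : ℤ)) * ∏ i, qPoch q q (n i) := by
    intro n
    simp only [rowFactor, momentScale, neg_neg]
    rw [Finset.prod_mul_distrib, Finset.prod_div_distrib, Finset.prod_pow_eq_pow_sum,
      Finset.prod_pow, Finset.prod_pow_eq_pow_sum, mul_pow, mul_div_assoc, ← Nat.cast_sum,
      ← Nat.cast_sum]
    congr 2
    rw [← zpow_natCast, ← zpow_natCast, ← zpow_natCast q, ← zpow_mul, ← zpow_mul,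
      ← zpow_sub₀ hq]
    congr 1
    push_cast
    ring
  rw [hprod, hprod, sum_shiftedRow l hl, sum_choose_shiftedRow l hl, ← Nat.cast_sum,
    sum_shiftedRow l hl, rowRatio, Finset.prod_div_distrib]
  have hne : ∏ i : Fin N, qPoch q q (N - 1 - (i : ℕ)) ≠ 0 :=
    Finset.prod_ne_zero_iff.mpr fun _ _ => hw _
  have hpow : q ^ ((2 * (N : ℤ) - 3) * ((l.card + ∑ i : Fin N, (N - 1 - (i : ℕ)) : ℕ) : ℤ) -
        2 * ((nStat l.transpose - nStat l + ((N : ℤ) - 1) * l.card) +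
          ∑ i : Fin N, ((N - 1 - (i : ℕ)).choose 2 : ℤ))) =
      q ^ (-(l.card : ℤ)) * q ^ (-2 * (nStat l.transpose - nStat l)) *
        q ^ ((2 * (N : ℤ) - 3) * (∑ i : Fin N, ((N - 1 - (i : ℕ) : ℕ) : ℤ)) -
          2 * ∑ i : Fin N, ((N - 1 - (i : ℕ)).choose 2 : ℤ)) := by
    rw [← zpow_add₀ hq, ← zpow_add₀ hq, Nat.cast_add, Nat.cast_sum]
    congr 1
    ring
  have hsplit : (a / (q * d)) ^ l.card = (a / d) ^ l.card * q ^ (-(l.card : ℤ)) := by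
    rw [zpow_neg, zpow_natCast, ← inv_pow, ← mul_pow]
    congr 1
    rw [div_mul_eq_div_mul_one_div, mul_comm, div_mul_eq_mul_div]
    field_simp
  rw [hpow, hsplit, pow_add]
  field_simp

end ensemble

/-! ### Determinants of orthogonal polynomials as q-Meixner functions in N variables -/

section meixner

variable {q a : ℝ} {c d : ℂ} (hw : ∀ n, qPoch q q n ≠ 0) (hq : (q : ℂ) ≠ 0) (ha : (a : ℂ) ≠ 0)
  (hc : c ≠ 0) (hd : d ≠ 0)

include hw hq ha hd

/-- The shift q^{1-N} in `momentParam` cancels the N in q^{m_j+N-1-j}, so the Pochhammer base is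
free of N. All other N-dependence separates into a row factor and a column factor. -/
theorem orthoCoeff_shiftedRow {N : ℕ} (l m : YoungDiagram) (i j : Fin N) :
    orthoCoeff q (momentScale q a d N) (momentParam q a c N) (shiftedRow N l i)
      (shiftedRow N m j) =
      rowFactor q a d N (shiftedRow N l i) / rowFactor q a d N (shiftedRow N m j) *
        sigmaEntry q a c l m i j := by
  have hi := shiftedRow_cast l i
  have hj := shiftedRow_cast m j
  rw [orthoCoeff, sigmaEntry]
  rcases le_or_gt (shiftedRow N m j) (shiftedRow N l i) with h | h
  · obtain ⟨r, hr⟩ := Nat.exists_eq_add_of_le h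
    have hr' : (l.rowLen i : ℤ) - (i : ℕ) - m.rowLen j + (j : ℕ) = (r : ℤ) := by omega
    have hparam : momentParam q a c N * (q : ℂ) ^ shiftedRow N m j =
        c / a * (q : ℂ) ^ ((m.rowLen j : ℤ) + 2 - (((j : ℕ) : ℤ) + 1)) := by
      have h1 : (q : ℂ) ^ ((m.rowLen j : ℤ) + 2 - (((j : ℕ) : ℤ) + 1)) =
          q * (q : ℂ) ^ (1 - (N : ℤ)) * (q : ℂ) ^ (shiftedRow N m j : ℤ) := by
        rw [← zpow_one_add₀ hq, ← zpow_add₀ hq]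
        congr 1
        omega
      rw [momentParam, h1, zpow_natCast]
      ring
    simp only [hr']
    rw [if_pos h, if_pos (by omega), Int.toNat_natCast, hparam, hr, Nat.add_sub_cancel_left, rowFactor,
      rowFactor, gaussBinom, if_pos (by omega), Nat.add_sub_cancel_left, pow_add]
    have h1 := hw r
    have h2 := hw (shiftedRow N m j)
    have h3 := neg_momentScale_ne_zero hq ha hd N
    generalize -momentScale (q : ℂ) a d N = B at h3 ⊢
    field_simp
  · rw [if_neg (by omega), if_neg (by omega), mul_zero]

theorem det_orthoCoeff {N : ℕ} {l m : YoungDiagram} (hl : l.colLen 0 ≤ N) (hm : m ≤ l)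
    (hc : c ≠ 0) :
    Matrix.det (Matrix.of fun i j => orthoCoeff q (momentScale q a d N) (momentParam q a c N)
      (shiftedRow N l i) (shiftedRow N m j)) =
      c ^ l.card * (rowRatio q N l / rowRatio q N m) * sigmaCoeff q a c d l m := by
  have hm' := (colLen_mono hm).trans hl
  simp only [orthoCoeff_shiftedRow hw hq ha hd]
  rw [det_div_mul (fun i => rowFactor (q : ℂ) a d N (shiftedRow N l i))
    (fun i => rowFactor (q : ℂ) a d N (shiftedRow N m i)) (fun i j => sigmaEntry q a c l m i j),
    prod_rowFactor hw hq _ _ hl, prod_rowFactor hw hq _ _ hm', sigmaCoeff,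
    det_reduce (sigmaEntry q a c l m) hl]
  · have h0 : ∏ i : Fin N, rowFactor (q : ℂ) a d N (N - 1 - (i : ℕ)) ≠ 0 :=
      Finset.prod_ne_zero_iff.mpr fun _ _ => rowFactor_ne_zero hw hq ha hd N _
    have h1 := rowRatio_ne_zero hw N m
    have h2 : (a : ℂ) / (q * d) ≠ 0 := div_ne_zero ha (mul_ne_zero hq hd)
    have h3 : (q : ℂ) ^ (2 * (nStat m.transpose - nStat m - nStat l.transpose + nStat l)) =
        (q : ℂ) ^ (-2 * (nStat l.transpose - nStat l)) /
          (q : ℂ) ^ (-2 * (nStat m.transpose - nStat m)) := by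
      rw [← zpow_sub₀ hq]
      congr 1
      ring
    have h4 := zpow_ne_zero (-2 * (nStat m.transpose - nStat m)) hq
    rw [h3, zpow_sub₀ h2, zpow_natCast, zpow_natCast, zpow_neg, zpow_natCast]
    generalize (a : ℂ) / (q * d) = B at h2 ⊢
    field_simp
  · intro i j hi hj
    rw [sigmaEntry, rowLen_eq_zero.mpr hi]
    exact if_neg (by omega)
  · intro i hi
    rw [sigmaEntry, rowLen_eq_zero.mpr hi, rowLen_eq_zero.mpr ((colLen_mono hm).trans hi)]
    simp [qPoch_zero]

include hc

theorem polyDet_orthoPoly {N : ℕ} {l : YoungDiagram} (hl : l.colLen 0 ≤ N) :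
    polyDet (fun i (_ : Fin N) => orthoPoly q (leadNode q N) (momentScale q a d N)
      (momentParam q a c N) (shiftedRow N l i)) =
      (c ^ l.card * rowRatio q N l) •
        (restrict N (schurScale q N (meixnerCore q a c d l)) * vandermonde N) := by
  set p := orthoCoeff q (momentScale (q : ℂ) a d N) (momentParam q a c N)
  -- T sends monomials to Newton polynomials, so that the Cauchy–Binet expansion, which is phrased
  -- in monomial coefficients, produces Newton determinants.
  set T : Polynomial ℂ →ₗ[ℂ] Polynomial ℂ :=
    (Polynomial.basisMonomials ℂ).constr ℂ (newtonUni q (leadNode q N))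
  have hT : ∀ k, T (Polynomial.X ^ k) = newtonUni q (leadNode q N) k := by
    intro k
    have h : Polynomial.X ^ k = Polynomial.basisMonomials ℂ k := by
      rw [Polynomial.coe_basisMonomials]
      exact (Polynomial.monomial_one_right_eq_X_pow k).symm
    rw [h]
    exact Module.Basis.constr_basis _ _ _ _
  set G : ℕ → Polynomial ℂ := fun n => ∑ k ∈ Finset.range (n + 1), p n k • Polynomial.X ^ k
  have hG : ∀ n, (G n).natDegree ≤ n := by
    intro n
    refine Polynomial.natDegree_sum_le_of_forall_le _ _ fun k hk => ?_
    refine (Polynomial.natDegree_smul_le _ _).trans ?_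
    rw [Polynomial.natDegree_X_pow]
    exact Nat.lt_succ_iff.mp (Finset.mem_range.mp hk)
  have hcoeff : ∀ n k, (G n).coeff k = p n k := by
    intro n k
    simp only [G, Polynomial.finsetSum_coeff, Polynomial.coeff_smul, Polynomial.coeff_X_pow,
      smul_eq_mul, mul_ite, mul_one, mul_zero]
    rw [Finset.sum_ite_eq]
    split_ifs with h
    · rfl
    · rw [Finset.mem_range] at h
      exact (if_neg (by omega)).symm
  have hTG : ∀ n, T (G n) = orthoPoly q (leadNode q N) (momentScale q a d N)
      (momentParam q a c N) n := by
    intro n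
    simp only [G, map_sum, map_smul, hT]
    rfl
  have h := det_eq_sum_det hl G hG
    (fun j => (Polynomial.aeval (MvPolynomial.X j : MvPolynomial (Fin N) ℂ)).toLinearMap ∘ₗ T)
  simp only [LinearMap.comp_apply, hTG, hT, AlgHom.toLinearMap_apply, hcoeff] at h
  rw [polyDet, h, meixnerCore, map_sum, map_sum, Finset.sum_mul, Finset.smul_sum]
  refine Finset.sum_congr rfl fun m hm => ?_
  have hm' := mem_subdiagrams.mp hm
  rw [det_orthoCoeff hw hq ha hd hl hm' hc, det_newtonUni_eq hw hq ((colLen_mono hm').trans hl),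
    map_smul, map_smul, smul_mul_assoc, smul_smul, smul_smul]
  congr 1
  have := rowRatio_ne_zero hw N m
  field_simp

omit hw ha hc hd in
theorem prod_orthoNorm (hw : ∀ n, qPoch (q : ℂ) q n ≠ 0) (hc : c ≠ 0) (hd : d ≠ 0) {N : ℕ}
    {l : YoungDiagram} (hl : l.colLen 0 ≤ N) :
    ∏ i, orthoNorm q (momentScale q a d N) (momentParam q a c N) (momentParam q a d N)
      (shiftedRow N l i) =
      (c ^ l.card) ^ 2 * normSqMeixner q a c d l * rowRatio q N l *
        ∏ i : Fin N, orthoNorm q (momentScale q a d N) (momentParam q a c N)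
          (momentParam q a d N) (N - 1 - (i : ℕ)) := by
  -- The square of the scale contributes 2(2N - 3) and q^{-n} contributes -1, hence 4N - 7.
  -- Subtracting 4(N - 1) from the binomials leaves the -3 that appears as q³ in the norm.
  have hprod : ∀ n : Fin N → ℕ, ∏ i, orthoNorm q (momentScale q a d N) (momentParam q a c N)
      (momentParam q a d N) (n i) =
      ((a / d) ^ 2) ^ (∑ i, n i) * (q : ℂ) ^ ((4 * (N : ℤ) - 7) * (∑ i, (n i : ℤ)) -
        4 * ∑ i, ((n i).choose 2 : ℤ)) * (∏ i, qPoch q q (n i)) *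
        (∏ i, qPoch (momentParam q a c N) q (n i)) *
          ∏ i, qPoch (momentParam q a d N) q (n i) := by
    intro n
    simp only [orthoNorm, momentScale]
    simp only [Finset.prod_mul_distrib, Finset.prod_pow_eq_pow_sum, Finset.prod_pow,
      pow_mul, neg_sq, mul_pow]
    congr 3
    rw [← Nat.cast_sum, ← Nat.cast_sum, mul_assoc, mul_assoc]
    congr 1
    rw [← zpow_natCast ((q : ℂ)⁻¹), ← zpow_natCast ((q : ℂ)⁻¹), inv_zpow', inv_zpow',
      ← zpow_natCast _ 4, ← zpow_natCast _ 2, ← zpow_mul, ← zpow_mul, ← zpow_natCast,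
      ← zpow_mul, ← zpow_add₀ hq, ← zpow_add₀ hq]
    congr 1
    push_cast
    ring
  rw [hprod, hprod, sum_shiftedRow l hl, sum_choose_shiftedRow l hl, ← Nat.cast_sum,
    sum_shiftedRow l hl, rowRatio, Finset.prod_div_distrib, momentParam, momentParam,
    prod_qPoch_shiftedRow hq _ l hl, prod_qPoch_shiftedRow hq _ l hl, normSqMeixner]
  have hne : ∏ i : Fin N, qPoch (q : ℂ) q (N - 1 - (i : ℕ)) ≠ 0 :=
    Finset.prod_ne_zero_iff.mpr fun _ _ => hw _
  have hpow : (q : ℂ) ^ ((4 * (N : ℤ) - 7) *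
        ((l.card + ∑ i : Fin N, (N - 1 - (i : ℕ)) : ℕ) : ℤ) -
        4 * ((nStat l.transpose - nStat l + ((N : ℤ) - 1) * l.card) +
          ∑ i : Fin N, ((N - 1 - (i : ℕ)).choose 2 : ℤ))) =
      (q : ℂ) ^ (4 * (nStat l - nStat l.transpose)) * ((q : ℂ) ^ (-3 : ℤ)) ^ l.card *
        (q : ℂ) ^ ((4 * (N : ℤ) - 7) * (∑ i : Fin N, ((N - 1 - (i : ℕ) : ℕ) : ℤ)) -
          4 * ∑ i : Fin N, ((N - 1 - (i : ℕ)).choose 2 : ℤ)) := by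
    rw [← zpow_natCast _ l.card, ← zpow_mul, ← zpow_add₀ hq, ← zpow_add₀ hq, Nat.cast_add,
      Nat.cast_sum]
    congr 1
    ring
  have hsplit : (c ^ l.card) ^ 2 * ((a : ℂ) ^ 2 / (c ^ 2 * d ^ 2 * (q : ℂ) ^ 3)) ^ l.card =
      ((a / d) ^ 2) ^ l.card * ((q : ℂ) ^ (-3 : ℤ)) ^ l.card := by
    have h3 : (q : ℂ) ^ (-3 : ℤ) = ((q : ℂ) ^ 3)⁻¹ := by rw [zpow_neg]; norm_cast
    have h4 : c ^ 2 * ((a : ℂ) ^ 2 / (c ^ 2 * d ^ 2 * (q : ℂ) ^ 3)) =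
        (a / d) ^ 2 * (q : ℂ) ^ (-3 : ℤ) := by
      rw [h3]
      field_simp
    rw [← mul_pow ((a / d : ℂ) ^ 2), ← h4, mul_pow, pow_right_comm]
  have hr : ∀ Q P : ℂ, (c ^ l.card) ^ 2 *
      (Q * ((a : ℂ) ^ 2 / (c ^ 2 * d ^ 2 * (q : ℂ) ^ 3)) ^ l.card * P) =
      Q * (((a / d) ^ 2) ^ l.card * ((q : ℂ) ^ (-3 : ℤ)) ^ l.card) * P := by
    intro Q P
    rw [← hsplit]
    ring
  rw [hpow, pow_add, hr]
  generalize ∏ i : Fin N, qPoch (q : ℂ) q (N - 1 - (i : ℕ)) = W at hne ⊢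
  generalize ∏ i, qPoch (q : ℂ) q (shiftedRow N l i) = X
  have hX : X = X / W * W := (div_mul_cancel₀ X hne).symm
  linear_combination (((a / d : ℂ) ^ 2) ^ l.card * ((a / d : ℂ) ^ 2) ^
    (∑ i : Fin N, (N - 1 - (i : ℕ))) * ((q : ℂ) ^ (4 * (nStat l - nStat l.transpose)) *
    ((q : ℂ) ^ (-3 : ℤ)) ^ l.card * (q : ℂ) ^ ((4 * (N : ℤ) - 7) *
    (∑ i : Fin N, ((N - 1 - (i : ℕ) : ℕ) : ℤ)) -
    4 * ∑ i : Fin N, ((N - 1 - (i : ℕ)).choose 2 : ℤ))) * qPochPartition (c * q / a) q l *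
    qPochPartition (d * q / a) q l *
    (∏ i : Fin N, qPoch (c * q / a * (q : ℂ) ^ (1 - (N : ℤ))) q (N - 1 - (i : ℕ))) *
    ∏ i : Fin N, qPoch (d * q / a * (q : ℂ) ^ (1 - (N : ℤ))) q (N - 1 - (i : ℕ))) * hX

end meixner

/-! ### The expectation in `N` variables and its limit -/

/-- The partition function of the polynomial ensemble in `N` variables. -/
def partitionFun (q a c d : ℂ) (N : ℕ) : ℂ :=
  (N.factorial : ℂ) * ∏ i : Fin N, orthoNorm q (momentScale q a d N) (momentParam q a c N)
    (momentParam q a d N) (N - 1 - (i : ℕ))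

/-- The expectation of a symmetric function in the polynomial ensemble in `N` variables. -/
def ensembleMean (q a c d : ℂ) (N : ℕ) : SymFun →ₗ[ℂ] ℂ :=
  (partitionFun q a c d N)⁻¹ •
    ((tensorMap fun _ => uniMoment q (leadNode q N) (momentScale q a d N) (momentParam q a c N)) ∘ₗ
      LinearMap.mulRight ℂ (vandermonde N * vandermonde N) ∘ₗ (restrict N).toLinearMap)

theorem ensembleMean_apply (q a c d : ℂ) (N : ℕ) (f : SymFun) :
    ensembleMean q a c d N f = (partitionFun q a c d N)⁻¹ *
      tensorMap (fun _ => uniMoment q (leadNode q N) (momentScale q a d N) (momentParam q a c N))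
        (restrict N f * (vandermonde N * vandermonde N)) := rfl

section meixner

variable {q a : ℝ} {c d : ℂ} (hw : ∀ n, qPoch q q n ≠ 0) (hq : (q : ℂ) ≠ 0) (ha : (a : ℂ) ≠ 0)
  (hc : c ≠ 0) (hd : d ≠ 0)
  (hcd : ∀ k : ℤ, (1 - c / a * (q : ℂ) ^ k) * (1 - d / a * (q : ℂ) ^ k) ≠ 0)

include hq in
theorem qPoch_momentParam_ne_zero {x : ℂ} (hx : ∀ k : ℤ, 1 - x / a * (q : ℂ) ^ k ≠ 0) (N n : ℕ) :
    qPoch (momentParam q a x N) q n ≠ 0 := by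
  refine Finset.prod_ne_zero_iff.mpr fun k _ => ?_
  have h := hx (1 + (1 - (N : ℤ)) + k)
  rw [zpow_add₀ hq, zpow_one_add₀ hq, zpow_natCast] at h
  rw [momentParam]
  convert h using 2
  ring

include hw hq ha hd hcd

theorem partitionFun_ne_zero (N : ℕ) : partitionFun q a c d N ≠ 0 := by
  refine mul_ne_zero (Nat.cast_ne_zero.mpr N.factorial_ne_zero)
    (Finset.prod_ne_zero_iff.mpr fun i _ => ?_)
  have h1 := qPoch_momentParam_ne_zero hq (fun k => left_ne_zero_of_mul (hcd k)) N (N - 1 - i)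
  have h2 := qPoch_momentParam_ne_zero hq (fun k => right_ne_zero_of_mul (hcd k)) N (N - 1 - i)
  have h3 := neg_ne_zero.mp (neg_momentScale_ne_zero hq ha hd N)
  have h4 := hw (N - 1 - i)
  rw [orthoNorm]
  have h5 := inv_ne_zero hq
  exact mul_ne_zero (mul_ne_zero (mul_ne_zero (mul_ne_zero (mul_ne_zero (pow_ne_zero _ h3)
    (pow_ne_zero _ (pow_ne_zero _ h5))) (pow_ne_zero _ h5)) h4) h1) h2

include hc

open scoped Classical in
-- The two factors V convert the quotients into determinants, and Andréief's identity reduces to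
-- one-variable orthogonality. Rescaling the determinants costs r_N(λ)², of which the product of
-- norms returns one power.
theorem ensembleMean_mul {N : ℕ} {l m : YoungDiagram} (hl : l.colLen 0 ≤ N)
    (hm : m.colLen 0 ≤ N) :
    ensembleMean q a c d N (schurScale q N (meixnerCore q a c d l) *
      schurScale q N (meixnerCore q a c d m)) =
      if l = m then normSqMeixner q a c d l * (rowRatio q N l)⁻¹ else 0 := by
  set u := leadNode (q : ℂ) N
  set A := momentScale (q : ℂ) a d N
  set β := momentParam (q : ℂ) a c N
  set γ := momentParam (q : ℂ) a d N
  have hβ : A * β = -(c / d * u) := momentScale_mul_param hq ha c N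
  have hγ : A * γ = -u := by
    rw [momentScale_mul_param hq ha d N, div_self hd, one_mul]
  have h1 := tensorMap_polyDet_mul_polyDet (uniMoment q u A β)
    (fun i => orthoPoly q u A β (shiftedRow N l i)) (fun i => orthoPoly q u A β (shiftedRow N m i))
  simp only [uniMoment_orthoPoly_mul hw hq hβ hγ] at h1
  rw [det_ite_strictAnti (shiftedRow_strictAnti N l) (shiftedRow_strictAnti N m) _,
    polyDet_orthoPoly hw hq ha hc hd hl, polyDet_orthoPoly hw hq ha hc hd hm, smul_mul_smul_comm,
    map_smul, smul_eq_mul] at h1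
  have h2 : ∀ x y v : MvPolynomial (Fin N) ℂ, x * v * (y * v) = x * y * (v * v) :=
    fun x y v => by ring
  rw [h2, ← map_mul] at h1
  have hrl := rowRatio_ne_zero hw N l
  have hrm := rowRatio_ne_zero hw N m
  have hZ := partitionFun_ne_zero hw hq ha hd hcd N
  have hcl := pow_ne_zero l.card hc
  have hcm := pow_ne_zero m.card hc
  rw [ensembleMean_apply]
  by_cases hlm : l = m
  · subst hlm
    rw [if_pos rfl, prod_orthoNorm hq hw hc hd hl] at h1
    rw [if_pos rfl, inv_mul_eq_iff_eq_mul₀ hZ]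
    refine mul_left_cancel₀ (mul_ne_zero (mul_ne_zero hcl hrl) (mul_ne_zero hcl hrl)) ?_
    rw [h1, partitionFun]
    field_simp
  · rw [if_neg fun h => hlm (shiftedRow_injective hl hm h), mul_zero] at h1
    rw [if_neg hlm, (mul_eq_zero.mp h1).resolve_left (mul_ne_zero (mul_ne_zero hcl hrl)
      (mul_ne_zero hcm hrm)), mul_zero]

omit hw hq ha hd hcd hc in
theorem meixnerCore_bot : meixnerCore q a c d ⊥ = 1 := by
  have hempty : IsEmpty (Fin ((⊥ : YoungDiagram).colLen 0)) := by rw [colLen_bot]; infer_instance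
  have hs : schurFun ⊥ = 1 := Matrix.det_isEmpty
  have hi : interpSchur q ⊥ = 1 := by
    rw [interpSchur, subdiagrams_bot, Finset.sum_singleton, interpCoeff_self, one_smul, hs]
  rw [meixnerCore, subdiagrams_bot, Finset.sum_singleton, hi, sigmaCoeff, Matrix.det_isEmpty]
  simp [YoungDiagram.card]

omit hq ha hd hcd hc in
theorem schurScale_one (N : ℕ) : schurScale (q : ℂ) N 1 = 1 := by
  have hempty : IsEmpty (Fin ((⊥ : YoungDiagram).colLen 0)) := by rw [colLen_bot]; infer_instance
  have hs : schurFun ⊥ = 1 := Matrix.det_isEmpty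
  have hr : rowRatio (q : ℂ) N ⊥ = 1 := by
    refine Finset.prod_eq_one fun i _ => ?_
    rw [shiftedRow, rowLen_bot, zero_add, div_self (hw _)]
  rw [← hs, schurScale_schurFun, hr, inv_one, one_smul]

open scoped Classical in
-- Orthogonality against the empty diagram, whose function is the constant 1, fixed by `schurScale`.
theorem ensembleMean_meixnerCore {N : ℕ} {l : YoungDiagram} (hl : l.colLen 0 ≤ N) :
    ensembleMean q a c d N (schurScale q N (meixnerCore q a c d l)) = if l = ⊥ then 1 else 0 := by
  have hbot : (⊥ : YoungDiagram).colLen 0 ≤ N := by rw [colLen_bot]; exact Nat.zero_le N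
  have h := ensembleMean_mul hw hq ha hc hd hcd hl hbot
  rw [meixnerCore_bot, schurScale_one hw, mul_one] at h
  rw [h]
  split_ifs with hl0
  · have hr : rowRatio (q : ℂ) N ⊥ = 1 := by
      refine Finset.prod_eq_one fun i _ => ?_
      rw [shiftedRow, rowLen_bot, zero_add, div_self (hw _)]
    have hbotT : (⊥ : YoungDiagram).transpose.colLen 0 = 0 := by
      rw [YoungDiagram.colLen_transpose, rowLen_bot]
    rw [hl0, hr, normSqMeixner, nStat, nStat, hbotT, qPochPartition, qPochPartition, colLen_bot]
    simp [YoungDiagram.card]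
  · rfl

/-! ### Passage to the limit of infinitely many variables -/

variable {b : Module.Basis YoungDiagram ℂ SymFun} (hb : ∀ l, b l = meixnerCore q a c d l)
include hb

open scoped Classical in
-- An equality rather than a limit: f involves finitely many basis elements, and N need only exceed
-- the lengths of their diagrams.
theorem eventually_ensembleMean_schurScale (f : SymFun) :
    ∀ᶠ N in atTop, ensembleMean q a c d N (schurScale q N f) = b.coord ⊥ f := by
  induction b.mem_span f using Submodule.span_induction with
  | mem x hx =>
    obtain ⟨l, rfl⟩ := hx
    filter_upwards [eventually_ge_atTop (l.colLen 0)] with N hN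
    rw [Module.Basis.coord_apply, Module.Basis.repr_self, Finsupp.single_apply, hb,
      ensembleMean_meixnerCore hw hq ha hc hd hcd hN]
  | zero => simp
  | add x y _ _ hx hy =>
    filter_upwards [hx, hy] with N h1 h2
    rw [map_add, map_add, map_add, h1, h2]
  | smul r x _ hx =>
    filter_upwards [hx] with N h1
    rw [map_smul, map_smul, map_smul, h1]

variable (hq1 : ‖(q : ℂ)‖ < 1)
include hq1

/-- On a Schur function `schurScale` is a nonzero scalar, so the preceding equality gives E_N(s_ν) =
r_N(ν) E(s_ν) for large N. -/
theorem tendsto_ensembleMean (f : SymFun) :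
    Tendsto (fun N => ensembleMean q a c d N f) atTop (𝓝 (b.coord ⊥ f)) := by
  induction schurBasis.mem_span f using Submodule.span_induction with
  | mem x hx =>
    obtain ⟨nu, rfl⟩ := hx
    rw [schurBasis_apply]
    have h : Tendsto (fun N => rowRatio q N nu * b.coord ⊥ (schurFun nu)) atTop
        (𝓝 (1 * b.coord ⊥ (schurFun nu))) := (tendsto_rowRatio hw hq1 nu).mul_const _
    rw [one_mul] at h
    refine h.congr' ?_
    filter_upwards [eventually_ensembleMean_schurScale hw hq ha hc hd hcd hb
      (schurFun nu)] with N hN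
    rw [← hN, schurScale_schurFun, map_smul, smul_eq_mul,
      mul_inv_cancel_left₀ (rowRatio_ne_zero hw N nu)]
  | zero => simp
  | add x y _ _ hx hy => simpa only [map_add] using hx.add hy
  | smul r x _ hx => simpa only [map_smul, smul_eq_mul] using hx.const_mul r

/-- The operator `schurScale` is not multiplicative, but by bilinearity two Schur functions suffice,
and there it contributes scalars tending to 1. -/
theorem tendsto_ensembleMean_mul (f g : SymFun) :
    Tendsto (fun N => ensembleMean q a c d N (schurScale q N f * schurScale q N g)) atTop
      (𝓝 (b.coord ⊥ (f * g))) := by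
  induction schurBasis.mem_span f using Submodule.span_induction with
  | mem x hx =>
    obtain ⟨nu, rfl⟩ := hx
    induction schurBasis.mem_span g using Submodule.span_induction with
    | mem y hy =>
      obtain ⟨rho, rfl⟩ := hy
      simp only [schurBasis_apply, schurScale_schurFun, smul_mul_smul_comm, map_smul, smul_eq_mul]
      have h := (((tendsto_rowRatio hw hq1 nu).inv₀ one_ne_zero).mul
        ((tendsto_rowRatio hw hq1 rho).inv₀ one_ne_zero)).mul
        (tendsto_ensembleMean hw hq ha hc hd hcd hb hq1 (schurFun nu * schurFun rho))
      simpa only [inv_one, one_mul] using h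
    | zero => simp
    | add x y _ _ hx hy => simpa only [map_add, mul_add] using hx.add hy
    | smul r x _ hx =>
      simpa only [map_smul, smul_eq_mul, mul_smul_comm] using hx.const_mul r
  | zero => simp
  | add x y _ _ hx hy => simpa only [map_add, add_mul] using hx.add hy
  | smul r x _ hx =>
    simpa only [map_smul, smul_eq_mul, smul_mul_assoc] using hx.const_mul r

open scoped Classical in
theorem coord_meixnerCore_mul (l m : YoungDiagram) :
    b.coord ⊥ (meixnerCore q a c d l * meixnerCore q a c d m) =
      if l = m then normSqMeixner q a c d l else 0 := by
  refine tendsto_nhds_unique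
    (tendsto_ensembleMean_mul hw hq ha hc hd hcd hb hq1 _ _) (Tendsto.congr' (f₁ := fun N =>
      if l = m then normSqMeixner q a c d l * (rowRatio q N l)⁻¹ else 0) ?_ ?_)
  · filter_upwards [eventually_ge_atTop (l.colLen 0), eventually_ge_atTop (m.colLen 0)]
      with N h1 h2
    rw [ensembleMean_mul hw hq ha hc hd hcd h1 h2]
  · split_ifs
    · have h := ((tendsto_rowRatio hw hq1 l).inv₀ one_ne_zero).const_mul
        (normSqMeixner q a c d l)
      simpa using h
    · exact tendsto_const_nhds

end meixner

/-! ### Dilation -/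

theorem dilate_mul (c : ℂ) (f g : SymFun) : dilate c (f * g) = dilate c f * dilate c g :=
  Subtype.ext (map_mul (MvPowerSeries.rescale fun _ => c) _ _)

theorem dilate_dilate (c c' : ℂ) (f : SymFun) : dilate c (dilate c' f) = dilate (c * c') f := by
  apply Subtype.ext
  ext α
  simp only [dilate, MvPowerSeries.coeff_rescale, Finsupp.prod, Finset.prod_pow_eq_pow_sum]
  ring

theorem dilate_one (f : SymFun) : dilate 1 f = f := by
  apply Subtype.ext
  ext α
  simp [dilate, MvPowerSeries.coeff_rescale, Finsupp.prod]

/-- Dilation by a nonzero number as a linear automorphism. -/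
def dilateEquiv (c : ℂ) (hc : c ≠ 0) : SymFun ≃ₗ[ℂ] SymFun where
  toFun := dilate c
  invFun := dilate c⁻¹
  map_add' f g := Subtype.ext (map_add (MvPowerSeries.rescale fun _ => c) _ _)
  map_smul' r f := by
    apply Subtype.ext
    ext α
    simp only [dilate, MvPowerSeries.coeff_rescale, SetLike.val_smul, MvPowerSeries.coeff_smul,
      RingHom.id_apply]
    ring
  left_inv f := by rw [dilate_dilate, inv_mul_cancel₀ hc, dilate_one]
  right_inv f := by rw [dilate_dilate, mul_inv_cancel₀ hc, dilate_one]

theorem dilateEquiv_apply (c : ℂ) (hc : c ≠ 0) (f : SymFun) : dilateEquiv c hc f = dilate c f := rfl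

theorem qPoch_self_ne_zero {q : ℝ} (hq0 : 0 < q) (hq1 : q < 1) (n : ℕ) : qPoch q q n ≠ 0 := by
  refine Finset.prod_ne_zero_iff.mpr fun k _ h => ?_
  have h1 : 1 - q * q ^ k = 0 := by exact_mod_cast h
  have h2 : q * q ^ k < 1 := by
    rw [← pow_succ']
    exact pow_lt_one₀ hq0.le hq1 (Nat.succ_ne_zero k)
  linarith

end QMeixner

end

/-- Formal orthogonality of the `q`-Meixner symmetric functions. -/
theorem mainTheorem7 (q : ℝ) (hq0 : 0 < q) (hq1 : q < 1) (a : ℝ) (c d : ℂ)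
    (hadm : QMeixner.IsAdmissible q a c d) :
    (∀ m : YoungDiagram,
      QMeixner.ConvergesTo (QMeixner.interpPoly q m) (QMeixner.interpFun q m)) ∧
    (∃ b : Module.Basis YoungDiagram ℂ QMeixner.SymFun,
      (∀ l : YoungDiagram, b l = QMeixner.qMeixner q a c d l) ∧
      (∀ l m : YoungDiagram, l ≠ m →
        QMeixner.momentForm b (QMeixner.qMeixner q a c d l) (QMeixner.qMeixner q a c d m) = 0) ∧
      (∀ l : YoungDiagram,
        QMeixner.momentForm b (QMeixner.qMeixner q a c d l) (QMeixner.qMeixner q a c d l)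
          = QMeixner.normSqMeixner q a c d l)) ∧
    (∀ l : YoungDiagram, ∃ r : ℝ, 0 < r ∧ QMeixner.normSqMeixner q a c d l = (r : ℂ)) := by
  classical
  open QMeixner in
  have hw := qPoch_self_ne_zero hq0 hq1
  have hq : (q : ℂ) ≠ 0 := by exact_mod_cast hq0.ne'
  have ha : (a : ℂ) ≠ 0 := by exact_mod_cast hadm.1.ne'
  have hnorm : ‖(q : ℂ)‖ < 1 := by
    rwa [Complex.norm_real, Real.norm_of_nonneg hq0.le]
  obtain ⟨r, hr, hcdr⟩ := hadm.exists_mul_pos hq0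
  have hcd0 : c * d ≠ 0 := by
    rw [hcdr]
    exact_mod_cast hr.ne'
  have hc : c ≠ 0 := left_ne_zero_of_mul hcd0
  have hd : d ≠ 0 := right_ne_zero_of_mul hcd0
  have hfac : ∀ k : ℤ, (1 - c / a * (q : ℂ) ^ k) * (1 - d / a * (q : ℂ) ^ k) ≠ 0 := by
    intro k
    obtain ⟨s, hs, hk⟩ := hadm.exists_factor_pos hq0 hq1 k
    rw [hk]
    exact_mod_cast hs.ne'
  obtain ⟨b, hb⟩ := exists_basis_meixnerCore q a hc d
  have hmeix : ∀ l, qMeixner q a c d l = dilateEquiv c hc (b l) := by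
    intro l
    rw [hb, meixnerCore, map_sum, qMeixner]
    refine Finset.sum_congr rfl fun m _ => ?_
    rw [map_smul, (interpFun_spec hw hq hnorm m).2, dilateEquiv_apply]
  have hform : ∀ l m, momentForm (b.map (dilateEquiv c hc)) (qMeixner q a c d l)
      (qMeixner q a c d m) = if l = m then normSqMeixner q a c d l else 0 := by
    intro l m
    -- The functional of the transported basis is the old one composed with the inverse dilation,
    -- and dilation respects products, so the form is unchanged.
    rw [momentForm, momentFunctional, hmeix, hmeix, dilateEquiv_apply, dilateEquiv_apply,
      ← dilate_mul, ← dilateEquiv_apply c hc, Module.Basis.coord_apply, Module.Basis.map_repr,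
      LinearEquiv.trans_apply, LinearEquiv.symm_apply_apply, ← Module.Basis.coord_apply, hb, hb,
      coord_meixnerCore_mul hw hq ha hc hd hfac hb hnorm]
  refine ⟨fun m => (interpFun_spec hw hq hnorm m).1,
    ⟨b.map (dilateEquiv c hc), fun l => ?_, fun l m hlm => ?_, fun l => ?_⟩,
    normSqMeixner_pos hq0 hq1 hadm⟩
  · rw [hmeix, Module.Basis.map_apply]
  · rw [hform, if_neg hlm]
  · rw [hform, if_pos rfl]
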